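/- Let $H$ be a finite simple graph, let $d$ be an integer, and let $H' = H[V']$ be the subgraph of $H$ induced by the set $V'$ of all vertices of degree more than $d$ in $H$. Then there is a linear parameterized reduction from $H'$-free Edge Deletion to $H$-free Edge Deletion. Here, for a fixed finite simple graph $Q$, the problem $Q$-free Edge Deletion asks, given a finite simple graph $G$ and an integer $k \ge 0$ (the parameter), whether there is a set $F$ of at most $k$ edges of $G$ such that $G - F$ has no induced subgraph isomorphic to $Q$. A linear parameterized reduction from a parameterized problem $A$ to a parameterized problem $B$ is a function that maps every instance $x$ of $A$ with parameter $k$ to an instance $x'$ of $B$ with parameter $k'$, is computable in polynomial time (with the parameter written in unary), satisfies that $x$ is a yes-instance of $A$ if and only if $x'$ is a yes-instance of $B$, and satisfies $k' \le c\,k$ for a constant $c$ that does not depend on $x$. -/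

import Mathlib

/-- An instance `(G, k)` of an edge deletion problem: a finite simple graph `G`, whose vertices are
numbered `0, …, n - 1`, and a natural number `k`. -/
structure EdgeDeletionInstance where
  n : ℕ
  G : SimpleGraph (Fin n)
  k : ℕ

/-- The adjacency matrix of a graph on `Fin n`, as the list of its rows. -/
noncomputable def adjacencyRows {n : ℕ} (G : SimpleGraph (Fin n)) : List (List Bool) :=
  open Classical in
  List.ofFn fun i : Fin n => List.ofFn fun j : Fin n => decide (G.Adj i j)

/-- The binary string which represents `(G, k)`: the string `1ⁿ 0 1ᵏ 0`, followed by the `n²` bits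
of the adjacency matrix of `G`, row by row. The parameter is written in unary, so that the length
of the input is polynomially related to `|G| + k`. -/
noncomputable def EdgeDeletionInstance.encode (I : EdgeDeletionInstance) : List Bool :=
  List.replicate I.n true ++ false ::
    (List.replicate I.k true ++ false :: (adjacencyRows I.G).flatten)

theorem unaryPrefix_inj {a b : ℕ} {l l' : List Bool}
    (h : List.replicate a true ++ false :: l = List.replicate b true ++ false :: l') :
    a = b ∧ l = l' := by
  induction a generalizing b with
  | zero =>
    cases b with
    | zero => simpa using h
    | succ b => simp [List.replicate_succ] at h
  | succ a ih =>
    cases b with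
    | zero => simp [List.replicate_succ] at h
    | succ b =>
      simp only [List.replicate_succ, List.cons_append, List.cons.injEq, true_and] at h
      obtain ⟨h1, h2⟩ := ih h
      exact ⟨by rw [h1], h2⟩

theorem adjacencyRows_flatten_inj {n : ℕ} {G G' : SimpleGraph (Fin n)}
    (h : (adjacencyRows G).flatten = (adjacencyRows G').flatten) : G = G' := by
  have hrows : adjacencyRows G = adjacencyRows G' := by
    rw [List.eq_iff_flatten_eq]
    refine ⟨h, ?_⟩
    simp [adjacencyRows, List.map_ofFn, Function.comp_def]
  have h1 := List.ofFn_injective hrows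
  ext i j
  have h2 := congrFun (List.ofFn_injective (congrFun h1 i)) j
  simpa using h2

theorem EdgeDeletionInstance.encode_injective :
    Function.Injective EdgeDeletionInstance.encode := by
  rintro ⟨n, G, k⟩ ⟨n', G', k'⟩ h
  obtain ⟨h1, h2⟩ := unaryPrefix_inj h
  obtain ⟨h3, h4⟩ := unaryPrefix_inj h2
  dsimp only at h1 h3 h4
  subst h1 h3
  rw [adjacencyRows_flatten_inj h4]

/-- A parameterized problem: a type of instances, each of which is represented by a binary string
and carries a parameter, with the predicate that picks out the yes-instances. -/
structure ParameterizedProblem where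
  Inst : Type
  encode : Inst → List Bool
  encode_injective : Function.Injective encode
  param : Inst → ℕ
  IsYes : Inst → Prop

/-- There is a linear parameterized reduction from `A` to `B`: a function computable in polynomial
time by a (multi-stack) Turing machine, which maps yes-instances to yes-instances and no-instances
to no-instances, and which increases the parameter by at most a constant factor. -/
def LinearParameterizedReducible (A B : ParameterizedProblem) : Prop :=
  ∃ f : A.Inst → B.Inst,
    Nonempty (Turing.TM2ComputableInPolyTime A.encode B.encode f) ∧
    (∀ x, A.IsYes x ↔ B.IsYes (f x)) ∧
    ∃ c : ℕ, ∀ x, B.param (f x) ≤ c * A.param x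

/-- `H`-free Edge Deletion: given `(G, k)`, is there a set `F` of at most `k` edges of `G` such that
`G - F` has no induced subgraph isomorphic to `H`? The parameter is `k`. -/
noncomputable def freeEdgeDeletion {V : Type*} (H : SimpleGraph V) : ParameterizedProblem where
  Inst := EdgeDeletionInstance
  encode := EdgeDeletionInstance.encode
  encode_injective := EdgeDeletionInstance.encode_injective
  param := EdgeDeletionInstance.k
  IsYes I := ∃ F : Finset (Sym2 (Fin I.n)),
    (F : Set (Sym2 (Fin I.n))) ⊆ I.G.edgeSet ∧ F.card ≤ I.k ∧
      ¬ H.IsIndContained (I.G.deleteEdges (F : Set (Sym2 (Fin I.n))))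

/-!
Let `P` be the set of vertices of `H` of degree more than `d`. The reduction keeps the parameter
`k`. For each function `f` from `P` to the vertices of `G` and each number `c ≤ k` it adds to `G` a
copy of the vertices of `H` outside `P`, with the edges of `H` among them, and joins the copy of `u`
to `f w` whenever `u` and `w ∈ P` are adjacent in `H`. If `f` is an embedding of `H[P]` into `G`,
then each of these copies completes it to an induced copy of `H`.

* Suppose that `G - F` is `H[P]`-free. A new vertex that imitates `u ∉ P` has at most as many
  neighbours as `u`, that is, at most `d`. So an induced copy of `H` in the constructed graph
  without `F` uses only vertices of `G` for the elements of `P`, and would contain an induced copy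
  of `H[P]` in `G - F` (`exists_position_eq`, `isYes_attach`).
* Suppose that the constructed graph without `F` is `H`-free and `F` has at most `k` edges. An
  induced copy of `H[P]` in `G - F` would be completed to copies of `H` in `k + 1` ways which share
  no edges outside `G`, and `F` cannot meet all of them (`isYes_of_isYes_attach`).

The functions `f` need not be injective, which only adds new vertices of small degree, and makes the
vertices of the constructed graph easy to enumerate.

To show that the reduction is computable in polynomial time, structured programs over stacks are
compiled to multi-stack machines. The relation `Exec` states the effect and the running time of a
program, and has a rule for each construct; `computableInPolyTime_of_exec` turns a program into a
machine. The program for the reduction enumerates the pairs of vertices of the constructed graph by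
nested loops. A vertex is represented by a tag, which is kept in the finite memory, and by digits,
which are kept in unary on stacks. For each pair the program compares the digits and writes an entry
of the adjacency matrix, which depends only on the tags and on the results of the comparisons. For
two vertices of `G` the entry has to be looked up in the input; but since the vertices of `G` come
first and in their order, these entries are requested in the order in which they appear in the
input, so that it suffices to pop them one by one (`exec_construct`, `flatten_adjacencyRows_eq`).
-/

namespace StackProgram

/-! ### A structured language for multi-stack machines -/

/-- Structured programs over Boolean stacks indexed by `K`. Besides the stacks, a program has a cell
that holds the result of the last `pop` (`none` if the stack was empty), and a variable of the
type `τ`. The command `loop k t a` pops `k`, stops if the popped symbol fails the test `t`, and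
otherwise runs `a` and starts again. -/
inductive Cmd (K τ : Type) where
  | push (k : K) (f : Option Bool → τ → Bool)
  | pop (k : K)
  | load (f : Option Bool → τ → τ)
  | seq (a b : Cmd K τ)
  | ite (f : Option Bool → τ → Bool) (a b : Cmd K τ)
  | loop (k : K) (t : Option Bool → Bool) (a : Cmd K τ)

section Language

variable {K τ : Type}

/-- The labels of the machine that executes a program: one for each of its commands other than
`seq`. -/
def Label : Cmd K τ → Type
  | .push _ _ => Unit
  | .pop _ => Unit
  | .load _ => Unit
  | .seq a b => Label a ⊕ Label b
  | .ite _ a b => Option (Label a ⊕ Label b)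
  | .loop _ _ a => Option (Label a)

theorem finite_label : (c : Cmd K τ) → Finite (Label c)
  | .push _ _ => inferInstanceAs (Finite Unit)
  | .pop _ => inferInstanceAs (Finite Unit)
  | .load _ => inferInstanceAs (Finite Unit)
  | .seq a b =>
    have := finite_label a
    have := finite_label b
    inferInstanceAs (Finite (Label a ⊕ Label b))
  | .ite _ a b =>
    have := finite_label a
    have := finite_label b
    inferInstanceAs (Finite (Option (Label a ⊕ Label b)))
  | .loop _ _ a =>
    have := finite_label a
    inferInstanceAs (Finite (Option (Label a)))

/-- The label at which the execution of a program starts. -/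
def entry : (c : Cmd K τ) → Label c
  | .push _ _ => ()
  | .pop _ => ()
  | .load _ => ()
  | .seq a _ => Sum.inl (entry a)
  | .ite _ _ _ => none
  | .loop _ _ _ => none

/-- Statements of a machine whose stacks are Boolean and whose internal state consists of the
last popped symbol and the variable of type `τ`. -/
abbrev MStmt (K τ Λ : Type) : Type := Turing.TM2.Stmt (fun _ : K => Bool) Λ (Option Bool × τ)

/-- The statements into which a program is compiled, when its labels are embedded by `e` into the
labels of a larger machine and control is to be passed to `x` at the end. -/
def code : (c : Cmd K τ) → {Λ : Type} → (Label c → Λ) → Λ → Label c → MStmt K τ Λ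
  | .push k f, _, _, x, _ => .push k (fun s => f s.1 s.2) (.goto fun _ => x)
  | .pop k, _, _, x, _ => .pop k (fun s o => (o, s.2)) (.goto fun _ => x)
  | .load f, _, _, x, _ => .load (fun s => (s.1, f s.1 s.2)) (.goto fun _ => x)
  | .seq a b, _, e, _, Sum.inl l =>
    code a (fun l => e (Sum.inl l)) (e (Sum.inr (entry b))) l
  | .seq _ b, _, e, x, Sum.inr l => code b (fun l => e (Sum.inr l)) x l
  | .ite f a b, _, e, _, none =>
    .branch (fun s => f s.1 s.2) (.goto fun _ => e (some (Sum.inl (entry a))))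
      (.goto fun _ => e (some (Sum.inr (entry b))))
  | .ite _ a _, _, e, x, some (Sum.inl l) => code a (fun l => e (some (Sum.inl l))) x l
  | .ite _ _ b, _, e, x, some (Sum.inr l) => code b (fun l => e (some (Sum.inr l))) x l
  | .loop k t a, _, e, x, none =>
    .pop k (fun s o => (o, s.2)) (.branch (fun s => t s.1)
      (.goto fun _ => e (some (entry a))) (.goto fun _ => x))
  | .loop _ _ a, _, e, _, some l => code a (fun l => e (some l)) (e none) l

variable [DecidableEq K]

/-- Started with last popped symbol `o`, variable `v` and stacks `S`, the program `c` ends after at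
most `n` machine steps with `o'`, `v'` and `S'`. The definition speaks of every machine that
contains the code of `c`. -/
def Exec (c : Cmd K τ) (o : Option Bool) (v : τ) (S : K → List Bool)
    (o' : Option Bool) (v' : τ) (S' : K → List Bool) (n : ℕ) : Prop :=
  ∀ (Λ : Type) (M : Λ → MStmt K τ Λ) (e : Label c → Λ) (x : Λ), (∀ l, M (e l) = code c e x l) →
    ∃ m ≤ n, (flip bind (Turing.TM2.step M))^[m] (some ⟨some (e (entry c)), (o, v), S⟩) =
      some ⟨some x, (o', v'), S'⟩

section

variable {a b c : Cmd K τ} {o o' o'' : Option Bool} {v v' v'' : τ} {S S' S'' : K → List Bool}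
  {m n : ℕ}

theorem Exec.mono (h : Exec c o v S o' v' S' m) (hmn : m ≤ n) : Exec c o v S o' v' S' n := by
  intro Λ M e x hM
  obtain ⟨i, hi, h⟩ := h Λ M e x hM
  exact ⟨i, hi.trans hmn, h⟩

theorem exec_push (k : K) (f : Option Bool → τ → Bool) :
    Exec (.push k f) o v S o v (Function.update S k (f o v :: S k)) 1 := by
  intro Λ M e x hM
  refine ⟨1, le_rfl, ?_⟩
  simp [flip, hM, code]

theorem exec_pop (k : K) :
    Exec (.pop k) o v S (S k).head? v (Function.update S k (S k).tail) 1 := by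
  intro Λ M e x hM
  refine ⟨1, le_rfl, ?_⟩
  simp [flip, hM, code]

theorem exec_load (f : Option Bool → τ → τ) : Exec (.load f) o v S o (f o v) S 1 := by
  intro Λ M e x hM
  refine ⟨1, le_rfl, ?_⟩
  simp [flip, hM, code]

theorem Exec.seq (ha : Exec a o v S o' v' S' m) (hb : Exec b o' v' S' o'' v'' S'' n) :
    Exec (.seq a b) o v S o'' v'' S'' (m + n) := by
  intro Λ M e x hM
  obtain ⟨i, hi, h1⟩ := ha Λ M (fun l => e (Sum.inl l)) (e (Sum.inr (entry b)))
    fun l => hM (Sum.inl l)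
  obtain ⟨j, hj, h2⟩ := hb Λ M (fun l => e (Sum.inr l)) x fun l => hM (Sum.inr l)
  refine ⟨j + i, by omega, ?_⟩
  rw [Function.iterate_add_apply]
  exact (congrArg _ h1).trans h2

theorem exec_ite_true {f : Option Bool → τ → Bool} (hf : f o v = true)
    (ha : Exec a o v S o' v' S' m) : Exec (.ite f a b) o v S o' v' S' (m + 1) := by
  intro Λ M e x hM
  have hM' := hM (entry _)
  obtain ⟨i, hi, h1⟩ := ha Λ M (fun l => e (some (Sum.inl l))) x fun l => hM (some (Sum.inl l))
  refine ⟨i + 1, by omega, ?_⟩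
  rw [Function.iterate_add_apply, ← h1]
  simp only [entry, code] at hM'
  simp [flip, entry, hM', hf]

theorem exec_ite_false {f : Option Bool → τ → Bool} (hf : f o v = false)
    (hb : Exec b o v S o' v' S' m) : Exec (.ite f a b) o v S o' v' S' (m + 1) := by
  intro Λ M e x hM
  have hM' := hM (entry _)
  obtain ⟨i, hi, h1⟩ := hb Λ M (fun l => e (some (Sum.inr l))) x fun l => hM (some (Sum.inr l))
  refine ⟨i + 1, by omega, ?_⟩
  rw [Function.iterate_add_apply, ← h1]
  simp only [entry, code] at hM'
  simp [flip, entry, hM', hf]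

theorem exec_loop_stop {k : K} {t : Option Bool → Bool} (ht : t (S k).head? = false) :
    Exec (.loop k t a) o v S (S k).head? v (Function.update S k (S k).tail) 1 := by
  intro Λ M e x hM
  have hM' := hM (entry _)
  refine ⟨1, le_rfl, ?_⟩
  simp only [entry, code] at hM'
  simp [flip, entry, hM', ht]

theorem exec_loop_step {k : K} {t : Option Bool → Bool} (ht : t (S k).head? = true)
    (ha : Exec a (S k).head? v (Function.update S k (S k).tail) o' v' S' m)
    (hl : Exec (.loop k t a) o' v' S' o'' v'' S'' n) :
    Exec (.loop k t a) o v S o'' v'' S'' (m + n + 1) := by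
  intro Λ M e x hM
  have hM' := hM (entry _)
  obtain ⟨i, hi, h1⟩ := ha Λ M (fun l => e (some l)) (e none) fun l => hM (some l)
  obtain ⟨j, hj, h2⟩ := hl Λ M e x hM
  refine ⟨j + (i + 1), by omega, ?_⟩
  rw [Function.iterate_add_apply, Function.iterate_add_apply _ i 1]
  refine Eq.trans (congrArg _ (Eq.trans ?_ h1)) h2
  congr 1
  simp only [entry, code] at hM'
  simp [flip, entry, hM', ht]

end

/-- The machine that executes the program `c` and halts. -/
noncomputable def machine [Fintype K] [Fintype τ] (c : Cmd K τ) (k₀ k₁ : K) (v : τ) :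
    Turing.FinTM2 :=
  haveI := finite_label c
  letI := Fintype.ofFinite (Label c)
  { K := K
    k₀ := k₀
    k₁ := k₁
    Γ := fun _ => Bool
    Λ := Option (Label c)
    main := some (entry c)
    σ := Option Bool × τ
    initialState := (none, v)
    Γk₀Fin := inferInstanceAs (Fintype Bool)
    m := fun l => l.elim .halt (code c some none) }

/-- A function between encoded types is computable in polynomial time if a program computes it
in polynomial time and leaves its variable and all stacks but the output stack as they were. -/
theorem computableInPolyTime_of_exec [Fintype K] [Fintype τ] {α β : Type} {ea : α → List Bool}
    {eb : β → List Bool} {f : α → β} (c : Cmd K τ) (k₀ k₁ : K) (v : τ) (time : Polynomial ℕ)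
    (h : ∀ x, Exec c none v (Function.update (fun _ => []) k₀ (ea x)) none v
      (Function.update (fun _ => []) k₁ (eb (f x))) (time.eval (ea x).length)) :
    Nonempty (Turing.TM2ComputableInPolyTime ea eb f) := by
  refine ⟨⟨⟨machine c k₀ k₁ v, Equiv.refl Bool, Equiv.refl Bool⟩, time + 1, fun x => ?_⟩⟩
  have hex : ∃ m ≤ time.eval (ea x).length + 1,
      (flip bind (machine c k₀ k₁ v).step)^[m]
        (some (Turing.initList (machine c k₀ k₁ v) (ea x))) =
        some (Turing.haltList (machine c k₀ k₁ v) (eb (f x))) := by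
    obtain ⟨m, hm, h1⟩ := h x _ (machine c k₀ k₁ v).m some none fun l => rfl
    -- one more step for the `halt` statement at the label `none`
    refine ⟨1 + m, by omega, ?_⟩
    have upd (k₀ k : K) (l : List Bool) :
        Function.update (fun _ => []) k₀ l k = if k = k₀ then l else [] :=
      Function.update_apply (fun _ => ([] : List Bool)) k₀ l k
    have e1 : Turing.initList (machine c k₀ k₁ v) (ea x) =
        ⟨some (some (entry c)), (none, v), Function.update (fun _ => []) k₀ (ea x)⟩ := by
      unfold Turing.initList
      congr 1
      funext k
      by_cases hk : k = k₀
      · exact (dif_pos hk).trans ((upd k₀ k _).trans (if_pos hk)).symm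
      · exact (dif_neg hk).trans ((upd k₀ k _).trans (if_neg hk)).symm
    have e2 : Turing.haltList (machine c k₀ k₁ v) (eb (f x)) =
        ⟨none, (none, v), Function.update (fun _ => []) k₁ (eb (f x))⟩ := by
      unfold Turing.haltList
      congr 1
      funext k
      by_cases hk : k = k₁
      · exact (dif_pos hk).trans ((upd k₁ k _).trans (if_pos hk)).symm
      · exact (dif_neg hk).trans ((upd k₁ k _).trans (if_neg hk)).symm
    rw [e1, e2, Function.iterate_add_apply]
    exact (congrArg _ h1).trans rfl
  choose m hm h1 using hex
  refine ⟨⟨m, ?_⟩, by simpa using hm⟩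
  change (flip bind (machine c k₀ k₁ v).step)^[m]
    (some (Turing.initList (machine c k₀ k₁ v) ((ea x).map id))) =
    some (Turing.haltList (machine c k₀ k₁ v) ((eb (f x)).map id))
  have e (l : List Bool) : l.map id = l := List.map_id l
  exact (congrArg₂ (fun l l' : List Bool => (flip bind (machine c k₀ k₁ v).step)^[m]
    (some (Turing.initList (machine c k₀ k₁ v) l)) =
    some (Turing.haltList (machine c k₀ k₁ v) l')) (e (ea x)) (e (eb (f x)))).mpr h1

end Language

/-! ### Programs with unary counters -/

section Counters

variable {D C τ : Type}

/-- The stacks of a program that has data stacks with contents `x`, and counters with values `c`,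
each of them kept in unary on a stack. -/
def layout (x : D → List Bool) (c : C → ℕ) : D ⊕ C → List Bool :=
  Sum.elim x fun k => List.replicate (c k) true

variable [DecidableEq D] [DecidableEq C]

theorem layout_update_inl (x : D → List Bool) (c : C → ℕ) (d : D) (l : List Bool) :
    Function.update (layout x c) (Sum.inl d) l = layout (Function.update x d l) c :=
  Sum.update_elim_inl

theorem layout_update_inr (x : D → List Bool) (c : C → ℕ) (k : C) (m : ℕ) :
    Function.update (layout x c) (Sum.inr k) (List.replicate m true) =
      layout x (Function.update c k m) := by
  unfold layout
  rw [Sum.update_elim_inr]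
  congr 1
  funext i
  by_cases hi : i = k
  · subst hi; simp
  · simp [hi]

/-- Whatever was popped last, the program `p` takes the variable, the data stacks and the counters
from `v`, `x`, `c` to `v'`, `x'`, `c'` in at most `n` steps. -/
def Does (p : Cmd (D ⊕ C) τ) (v : τ) (x : D → List Bool) (c : C → ℕ)
    (v' : τ) (x' : D → List Bool) (c' : C → ℕ) (n : ℕ) : Prop :=
  ∀ o, ∃ o', Exec p o v (layout x c) o' v' (layout x' c') n

variable {p q : Cmd (D ⊕ C) τ} {v v' v'' : τ} {x x' x'' : D → List Bool} {c c' c'' : C → ℕ}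
  {m n : ℕ}

theorem Does.mono (h : Does p v x c v' x' c' m) (hmn : m ≤ n) : Does p v x c v' x' c' n :=
  fun o => (h o).imp fun _ h => h.mono hmn

theorem Does.of_eq {y' : D → List Bool} {d' : C → ℕ} (h : Does p v x c v' x' c' m) (hx : x' = y')
    (hc : c' = d') : Does p v x c v' y' d' m := by
  rwa [← hx, ← hc]

theorem Does.seq (hp : Does p v x c v' x' c' m) (hq : Does q v' x' c' v'' x'' c'' n) :
    Does (.seq p q) v x c v'' x'' c'' (m + n) := by
  intro o
  obtain ⟨o₁, h₁⟩ := hp o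
  obtain ⟨o₂, h₂⟩ := hq o₁
  exact ⟨o₂, h₁.seq h₂⟩

theorem does_load (f : τ → τ) : Does (.load fun _ => f) v x c (f v) x c 1 :=
  fun o => ⟨o, exec_load _⟩

theorem does_ite {f : τ → Bool}
    (hp : f v = true → Does p v x c v' x' c' m) (hq : f v = false → Does q v x c v' x' c' m) :
    Does (.ite (fun _ => f) p q) v x c v' x' c' (m + 1) := by
  intro o
  cases hf : f v
  · obtain ⟨o', h⟩ := hq hf o
    exact ⟨o', exec_ite_false hf h⟩
  · obtain ⟨o', h⟩ := hp hf o
    exact ⟨o', exec_ite_true hf h⟩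

theorem does_push (d : D) (f : τ → Bool) :
    Does (.push (.inl d) fun _ => f) v x c v (Function.update x d (f v :: x d)) c 1 := by
  intro o
  refine ⟨o, ?_⟩
  rw [← layout_update_inl]
  exact exec_push _ _

/-- Adds one to a counter. -/
def inc (k : C) : Cmd (D ⊕ C) τ := .push (.inr k) fun _ _ => true

theorem does_inc (k : C) :
    Does (inc k) v x c v x (Function.update c k (c k + 1)) 1 := by
  intro o
  refine ⟨o, ?_⟩
  rw [← layout_update_inr]
  exact exec_push _ _

omit [DecidableEq D] [DecidableEq C] in
theorem head?_layout_inr (k : C) :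
    (layout x c (.inr k)).head? = if c k = 0 then none else some true := by
  simp [layout, List.head?_replicate]

theorem exec_pop_counter (k : C) (o : Option Bool) :
    Exec (.pop (.inr k)) o v (layout x c) (if c k = 0 then none else some true) v
      (layout x (Function.update c k (c k - 1))) 1 := by
  rw [← layout_update_inr, ← head?_layout_inr (x := x)]
  have h := exec_pop (o := o) (v := v) (S := layout x c) (Sum.inr k)
  have e : (layout x c (.inr k)).tail = List.replicate (c k - 1) true := by simp [layout]
  rwa [e] at h

/-- Runs `p` as often as the value of the counter `k` says, and counts `k` down to zero. -/
def countdown (k : C) (p : Cmd (D ⊕ C) τ) : Cmd (D ⊕ C) τ := .loop (.inr k) Option.isSome p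

/-- The rule for `countdown`: `V i`, `X i` and `Y i` are the variable, the data stacks and the
counters after `i` rounds. -/
theorem does_countdown {k : C} {n T : ℕ} (V : ℕ → τ) (X : ℕ → D → List Bool) (Y : ℕ → C → ℕ)
    (hk : ∀ i ≤ n, Y i k = n - i)
    (hp : ∀ i < n, Does p (V i) (X i) (Function.update (Y i) k (n - (i + 1)))
      (V (i + 1)) (X (i + 1)) (Y (i + 1)) T) :
    Does (countdown k p) (V 0) (X 0) (Y 0) (V n) (X n) (Y n) (n * (T + 1) + 1) := by
  intro o
  refine ⟨none, ?_⟩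
  suffices H : ∀ j ≤ n, ∀ o, Exec (countdown k p) o (V (n - j)) (layout (X (n - j)) (Y (n - j)))
      none (V n) (layout (X n) (Y n)) (j * (T + 1) + 1) by
    simpa using H n le_rfl o
  intro j
  induction j with
  | zero =>
    intro _ o
    have h0 : Y n k = 0 := by simpa using hk n le_rfl
    have h := exec_loop_stop (a := p) (o := o) (v := V n) (S := layout (X n) (Y n)) (k := .inr k)
      (t := Option.isSome) (by simp [head?_layout_inr, h0])
    rw [head?_layout_inr, if_pos h0] at h
    have e : (layout (X n) (Y n) (.inr k)).tail = layout (X n) (Y n) (.inr k) := by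
      simp [layout, h0]
    rw [e, Function.update_eq_self] at h
    simpa [countdown] using h
  | succ j ih =>
    intro hj o
    have hy : Y (n - (j + 1)) k = j + 1 := by rw [hk _ (by omega)]; omega
    have hi : n - (j + 1) + 1 = n - j := by omega
    have e : Function.update (layout (X (n - (j + 1))) (Y (n - (j + 1)))) (.inr k)
        (layout (X (n - (j + 1))) (Y (n - (j + 1))) (.inr k)).tail =
        layout (X (n - (j + 1))) (Function.update (Y (n - (j + 1))) k (n - (n - (j + 1) + 1))) := by
      rw [← layout_update_inr]
      congr 1
      simp only [layout, Sum.elim_inr, List.tail_replicate, hy]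
      congr 1
      omega
    obtain ⟨o', h⟩ := hp (n - (j + 1)) (by omega)
      (layout (X (n - (j + 1))) (Y (n - (j + 1))) (.inr k)).head?
    rw [← e, hi] at h
    refine (exec_loop_step ?_ h (ih (by omega) o')).mono ?_
    · simp [head?_layout_inr, hy]
    · rw [Nat.succ_mul]; omega

/-- The command without effect. -/
def skip : Cmd (D ⊕ C) τ := .load fun _ v => v

/-- Sets a counter to zero. -/
def clear (k : C) : Cmd (D ⊕ C) τ := countdown k skip

theorem does_clear (k : C) :
    Does (clear k) v x c v x (Function.update c k 0) (c k * 2 + 1) := by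
  have h := does_countdown (p := skip) (k := k) (n := c k) (T := 1) (fun _ => v) (fun _ => x)
    (fun i => Function.update c k (c k - i)) (by simp) (by
      intro i hi
      simpa using! does_load (v := v) (x := x) (c := Function.update c k (c k - (i + 1)))
        fun v => v)
  unfold clear
  simpa using h

/-- Moves the value of the counter `a` to the counter `b`. -/
def moveCounter (a b : C) : Cmd (D ⊕ C) τ := countdown a (inc b)

theorem does_moveCounter {a b : C} (hab : a ≠ b) :
    Does (moveCounter a b) v x c v x
      (Function.update (Function.update c a 0) b (c b + c a)) (c a * 2 + 1) := by
  have h := does_countdown (p := inc b) (k := a) (n := c a) (T := 1) (fun _ => v) (fun _ => x)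
    (fun i => Function.update (Function.update c a (c a - i)) b (c b + i)) (by
      intro i _
      simp [Function.update_of_ne hab]) (by
      intro i hi
      convert does_inc (x := x) (v := v) b using 1
      grind [Function.update_apply])
  unfold moveCounter
  simpa using h

/-- Copies the value of the counter `r` to the counter `b`, with the help of the counter `t`. -/
def copyCounter (r b t : C) : Cmd (D ⊕ C) τ :=
  .seq (countdown r (.seq (inc b) (inc t))) (moveCounter t r)

theorem does_copyCounter {r b t : C} (hrb : r ≠ b) (hrt : r ≠ t) (hbt : b ≠ t) (hb : c b = 0)
    (ht : c t = 0) :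
    Does (copyCounter r b t) v x c v x (Function.update c b (c r)) (c r * 5 + 2) := by
  have h := does_countdown (p := .seq (inc b) (inc t)) (k := r) (n := c r) (T := 1 + 1)
    (fun _ => v) (fun _ => x)
    (fun i => Function.update (Function.update (Function.update c r (c r - i)) b i) t i) (by
      intro i _
      simp [Function.update_of_ne hrb, Function.update_of_ne hrt]) (by
      intro i hi
      convert (does_inc (x := x) (v := v) b).seq (does_inc t) using 1
      grind [Function.update_apply])
  refine Does.mono (?_ : Does _ _ _ _ _ _ _ ((c r * 3 + 1) + (c r * 2 + 1))) (by omega)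
  refine Does.seq (v' := v) (x' := x)
    (c' := Function.update (Function.update (Function.update c r 0) b (c r)) t (c r))
    ?_ ?_
  · convert h using 1
    · grind [Function.update_apply]
    · simp
  · convert does_moveCounter (x := x) (v := v) (Ne.symm hrt) using 1
    · grind [Function.update_apply]
    · simp

/-- Runs `p` with the counter `a` at `0, 1, …, m - 1`, where `m` is the value of the counter `r`.
The counters `b` and `t` are auxiliary. -/
def forCounter (a b r t : C) (p : Cmd (D ⊕ C) τ) : Cmd (D ⊕ C) τ :=
  .seq (copyCounter r b t) (.seq (countdown b (.seq p (inc a))) (clear a))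

/-- The program `p` transforms the data stacks by `F` and preserves the variable and the
counters. -/
def Transforms (p : Cmd (D ⊕ C) τ) (v : τ) (c : C → ℕ) (F : (D → List Bool) → (D → List Bool))
    (n : ℕ) : Prop :=
  ∀ x, Does p v x c v (F x) c n

theorem Transforms.mono {F : (D → List Bool) → (D → List Bool)} (h : Transforms p v c F m)
    (hmn : m ≤ n) : Transforms p v c F n :=
  fun x => (h x).mono hmn

theorem transforms_forCounter {a b r t : C} (hab : a ≠ b)
    (hbr : b ≠ r) (hbt : b ≠ t) (hrt : r ≠ t)
    (ha : c a = 0) (hb : c b = 0) (ht : c t = 0) {T : ℕ}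
    {F : ℕ → (D → List Bool) → (D → List Bool)}
    (hp : ∀ i < c r, ∀ j,
      Transforms p v (Function.update (Function.update c a i) b j) (F i) T) :
    Transforms (forCounter a b r t p) v c
      (fun x => (List.range (c r)).foldl (fun x i => F i x) x) ((c r + 1) * (T + 9)) := by
  intro x
  have h := does_countdown (p := .seq p (inc a)) (k := b) (n := c r) (T := T + 1)
    (fun _ => v) (fun i => (List.range i).foldl (fun x i => F i x) x)
    (fun i => Function.update (Function.update c a i) b (c r - i)) (by simp) (by
      intro i hi
      convert (hp i hi (c r - (i + 1)) ((List.range i).foldl (fun x i => F i x) x)).seq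
        (does_inc a) using 1
      · simp
      · simp [List.range_succ]
      · grind [Function.update_apply])
  refine Does.mono (?_ : Does _ _ _ _ _ _ _
    ((c r * 5 + 2) + ((c r * ((T + 1) + 1) + 1) + (c r * 2 + 1)))) (by nlinarith)
  refine (does_copyCounter hbr.symm hrt hbt hb ht).seq (Does.seq (v' := v)
    (x' := (List.range (c r)).foldl (fun x i => F i x) x)
    (c' := Function.update (Function.update c a (c r)) b 0) ?_ ?_)
  · convert h using 1
    · simp
    · grind [Function.update_apply]
    · simp
  · convert does_clear (D := D) a using 1
    · grind [Function.update_apply]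
    · simp [Function.update_of_ne hab]

/-- Decrements the counter `k` and runs `p` if `k` is positive, and runs `q` otherwise. -/
def popThen (k : C) (p q : Cmd (D ⊕ C) τ) : Cmd (D ⊕ C) τ :=
  .seq (.pop (.inr k)) (.ite (fun o _ => o.isSome) p q)

theorem does_popThen {k : C} (h0 : c k = 0 → Does q v x c v' x' c' m)
    (h1 : c k ≠ 0 → Does p v x (Function.update c k (c k - 1)) v' x' c' m) :
    Does (popThen k p q) v x c v' x' c' (m + 2) := by
  intro o
  have h := exec_pop_counter (D := D) (τ := τ) (x := x) (v := v) (c := c) k o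
  by_cases hk : c k = 0
  · rw [if_pos hk, hk, Nat.zero_sub, ← hk, Function.update_eq_self] at h
    obtain ⟨o', h'⟩ := h0 hk none
    exact ⟨o', (h.seq (exec_ite_false rfl h')).mono (by omega)⟩
  · rw [if_neg hk] at h
    obtain ⟨o', h'⟩ := h1 hk (some true)
    exact ⟨o', (h.seq (exec_ite_true rfl h')).mono (by omega)⟩

/-- Runs the programs of a list one after the other. -/
def seqList (l : List (Cmd (D ⊕ C) τ)) : Cmd (D ⊕ C) τ := l.foldr .seq skip

theorem does_skip : Does skip v x c v x c 1 := does_load fun v => v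

/-- Moves the contents of the data stack `d`, in reverse order, onto the data stack `e`. -/
def moveData (d e : D) : Cmd (D ⊕ C) τ :=
  .loop (.inl d) Option.isSome (.push (.inl e) fun o _ => o == some true)

theorem does_moveData {d e : D} (hde : d ≠ e) :
    Does (moveData d e) v x c v
      (Function.update (Function.update x d []) e ((x d).reverse ++ x e)) c
      ((x d).length * 2 + 1) := by
  suffices H : ∀ (l : List Bool) (x : D → List Bool), x d = l →
      Does (moveData d e) v x c v
        (Function.update (Function.update x d []) e (l.reverse ++ x e)) c (l.length * 2 + 1) from
    H _ _ rfl
  intro l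
  induction l with
  | nil =>
    intro x hx o
    refine ⟨none, ?_⟩
    have h := exec_loop_stop (a := .push (.inl e) fun o _ => o == some true) (o := o) (v := v)
      (S := layout x c) (k := .inl d) (t := Option.isSome) (by simp [layout, hx])
    have e1 : layout x c (.inl d) = [] := hx
    rw [e1, List.tail_nil, layout_update_inl] at h
    have e2 : Function.update (Function.update x d []) e ([].reverse ++ x e) =
        Function.update x d [] := by grind [Function.update_apply]
    rw [e2]
    exact h
  | cons a l ih =>
    intro x hx o
    have e1 : layout x c (.inl d) = a :: l := hx
    have h := exec_push (o := some a) (v := v) (S := layout (Function.update x d l) c) (.inl e)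
      fun o _ => o == some true
    rw [layout_update_inl] at h
    obtain ⟨o', h'⟩ := ih (Function.update (Function.update x d l) e (a :: x e))
      (by simp [Function.update_of_ne hde]) (some a)
    refine ⟨o', ?_⟩
    have h2 := exec_loop_step (o := o) (k := .inl d) (S := layout x c) (t := Option.isSome)
      (a := .push (.inl e) fun o _ => o == some true) (by simp [e1]) (by
        rw [e1, List.head?_cons, List.tail_cons, layout_update_inl]
        exact h) (by
        have e2 : layout (Function.update x d l) c (.inl e) = x e := by
          simp [layout, Function.update_of_ne hde.symm]
        simpa [e2] using! h')
    have e3 : Function.update (Function.update x d []) e ((a :: l).reverse ++ x e) =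
        Function.update (Function.update (Function.update (Function.update x d l) e (a :: x e))
          d []) e (l.reverse ++ a :: x e) := by grind [Function.update_apply]
    rw [e3]
    exact h2.mono (by simp only [List.length_cons]; omega)

/-- Removes a block of ones and the zero behind it from the data stack `d`, and adds the number of
the ones to the counter `k`. -/
def readUnary (d : D) (k : C) : Cmd (D ⊕ C) τ := .loop (.inl d) (fun o => o == some true) (inc k)

theorem does_readUnary {d : D} {k : C} {n : ℕ} {l : List Bool}
    (hd : x d = List.replicate n true ++ false :: l) :
    Does (readUnary d k) v x c v (Function.update x d l) (Function.update c k (c k + n))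
      (n * 2 + 1) := by
  induction n generalizing x c with
  | zero =>
    intro o
    have e1 : layout x c (.inl d) = false :: l := hd
    have h := exec_loop_stop (a := inc k) (o := o) (v := v)
      (S := layout x c) (k := .inl d) (t := fun o => o == some true) (by simp [e1])
    rw [e1, layout_update_inl] at h
    exact ⟨_, by simpa [readUnary] using h⟩
  | succ n ih =>
    intro o
    have e1 : layout x c (.inl d) = true :: (List.replicate n true ++ false :: l) := hd
    obtain ⟨o₁, h₁⟩ := does_inc (τ := τ) (v := v) (c := c)
      (x := Function.update x d (List.replicate n true ++ false :: l)) k (some true)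
    obtain ⟨o₂, h₂⟩ := ih (x := Function.update x d (List.replicate n true ++ false :: l))
      (c := Function.update c k (c k + 1)) (by simp) o₁
    refine ⟨o₂, ?_⟩
    have h := exec_loop_step (o := o) (k := .inl d) (S := layout x c)
      (t := fun o => o == some true) (a := inc k) (by simp [e1]) (by
        rw [e1, List.head?_cons, List.tail_cons, layout_update_inl]
        exact h₁) h₂
    rw [Function.update_idem, Function.update_idem, Function.update_self, add_assoc,
      add_comm 1 n] at h
    exact h.mono (by omega)

end Counters

/-! ### Loops over the vertices of the constructed graph -/

/-- The data stacks: the input, the matrix under construction, the number of its rows in unary, and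
the output. -/
inductive Data where
  | input
  | matrix
  | rows
  | output
  deriving DecidableEq

instance : Fintype Data where
  elems := {.input, .matrix, .rows, .output}
  complete := by rintro ⟨⟩ <;> simp

/-- The counters: the order of the input graph, the number of copies, two auxiliary counters, and
for the row (`false`) and the column (`true`) the digits of the current vertex and the loop
counters that go with them. -/
inductive Counter (ι : Type) where
  | order
  | copies
  | aux
  | aux'
  | digit (b : Bool) (i : ι)
  | bound (b : Bool) (i : ι)
  deriving DecidableEq, Fintype

/-- A vertex of the constructed graph, as its tag and its digits. An original vertex has the tag
`none`, its number is the digit `none`, and its other digits vanish. A new vertex has the tag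
`some u`, where `u` is the vertex of `H` which it imitates; its digit `none` is the number of the
copy, and its digits `some w` are the numbers of the original vertices to which the copy is
attached. -/
abbrev Vertex (V : Type) : Type := Option V × (Option V → ℕ)

/-- The variable of the program: the tags of the row and of the column, and a table that says which
digits of the row and of the column are equal. -/
abbrev Var (V : Type) : Type := (Bool → Option V) × (Option V → Option V → Bool)

section Loops

variable {V : Type} [DecidableEq V]

/-- All ways to overwrite the digits `some w`, for `w` in a list, by numbers less than `n`. -/
def digitFunctions (n : ℕ) : List V → (Option V → ℕ) → List (Option V → ℕ)
  | [], g => [g]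
  | w :: l, g =>
    (List.range n).flatMap fun a => digitFunctions n l (Function.update g (some w) a)

/-- The original vertices. -/
def originals (n : ℕ) : List (Vertex V) :=
  (List.range n).map fun a => (none, Function.update 0 none a)

/-- The new vertices that imitate `u`. -/
def satellites (n m : ℕ) (l : List V) (u : V) : List (Vertex V) :=
  (List.range m).flatMap fun a =>
    (digitFunctions n l (Function.update 0 none a)).map fun f => (some u, f)

/-- The vertices of the constructed graph: the `n` original vertices, and for each `u` in `q`, each
of `m` copies and each assignment of original vertices to the elements of `l` a new vertex. -/
def vertices (n m : ℕ) (q l : List V) : List (Vertex V) :=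
  originals n ++ q.flatMap (satellites n m l)

/-- Programs for the construction. -/
abbrev Prog (V : Type) : Type := Cmd (Data ⊕ Counter (Option V)) (Var V)

/-- Sets a tag. -/
def setTag (b : Bool) (t : Option V) (v : Var V) : Var V := (Function.update v.1 b t, v.2)

/-- A loop that runs through the values of a digit; `r` is the counter that holds their number. -/
def forDigit (b : Bool) (i : Option V) (r : Counter (Option V)) (p : Prog V) : Prog V :=
  forCounter (.digit b i) (.bound b i) r .aux p

/-- Nested loops that run through `digitFunctions`. -/
def forDigits (b : Bool) (l : List V) (p : Prog V) : Prog V :=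
  l.foldr (fun w p => forDigit b (some w) .order p) p

/-- Runs through `originals`. -/
def forOriginals (b : Bool) (p : Prog V) : Prog V :=
  .seq (.load fun _ => setTag b none) (forDigit b none .order p)

/-- Runs through `satellites`. -/
def forSatellites (b : Bool) (l : List V) (p : Prog V) (u : V) : Prog V :=
  .seq (.load fun _ => setTag b (some u)) (forDigit b none .copies (forDigits b l p))

/-- Runs through `vertices`. -/
def forVertices (b : Bool) (q l : List V) (p : Prog V) : Prog V :=
  .seq (forOriginals b p)
    (.seq (seqList (q.map (forSatellites b l p))) (.load fun _ => setTag b none))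

/-- The values `c` and `c'` differ at most in the counters that belong to the current row (`false`)
or column (`true`). -/
def AgreeOff (b : Bool) (c c' : Counter (Option V) → ℕ) : Prop :=
  ∀ k, (∀ i, k ≠ .digit b i) → (∀ i, k ≠ .bound b i) → c' k = c k

omit [DecidableEq V] in
theorem AgreeOff.trans {b : Bool} {c c' c'' : Counter (Option V) → ℕ} (h : AgreeOff b c c')
    (h' : AgreeOff b c' c'') : AgreeOff b c c'' :=
  fun k h1 h2 => (h' k h1 h2).trans (h k h1 h2)

theorem agreeOff_update (b : Bool) (c : Counter (Option V) → ℕ) (i : Option V) (x y : ℕ) :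
    AgreeOff b c (Function.update (Function.update c (.digit b i) x) (.bound b i) y) := by
  intro k h1 h2
  rw [Function.update_of_ne (h2 i), Function.update_of_ne (h1 i)]

/-- The time for `r` nested loops of at most `s` rounds, if the innermost body takes time `T`. -/
def loopTime (s : ℕ) : ℕ → ℕ → ℕ
  | 0, T => T
  | r + 1, T => (s + 1) * (loopTime s r T + 9)

variable {b : Bool} {p : Prog V} {v : Var V} {s T : ℕ}

theorem transforms_forDigits {n : ℕ} (hn : n ≤ s)
    {F : (Option V → ℕ) → (Data → List Bool) → (Data → List Bool)}
    (l : List V) (hl : l.Nodup) (g : Option V → ℕ) (c : Counter (Option V) → ℕ)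
    (ho : c .order = n) (ha : c .aux = 0) (hg : ∀ i, c (.digit b i) = g i)
    (hd : ∀ w ∈ l, c (.digit b (some w)) = 0) (hb : ∀ w ∈ l, c (.bound b (some w)) = 0)
    (hp : ∀ f ∈ digitFunctions n l g, ∀ c', AgreeOff b c c' → (∀ i, c' (.digit b i) = f i) →
      Transforms p v c' (F f) T) :
    Transforms (forDigits b l p) v c
      (fun x => (digitFunctions n l g).foldl (fun x f => F f x) x) (loopTime s l.length T) := by
  induction l generalizing g c with
  | nil => exact hp g (by simp [digitFunctions]) c (fun _ _ _ => rfl) hg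
  | cons w l ih =>
    have hw : w ∉ l := (List.nodup_cons.mp hl).1
    have h := transforms_forCounter (a := .digit b (some w)) (b := .bound b (some w))
      (r := .order) (t := .aux) (p := forDigits b l p) (v := v) (c := c)
      (F := fun a x => (digitFunctions n l (Function.update g (some w) a)).foldl
        (fun x f => F f x) x) (T := loopTime s l.length T)
      (by simp) (by simp) (by simp) (by simp) (hd w (by simp)) (hb w (by simp)) ha (by
        intro a han j
        apply ih (List.nodup_cons.mp hl).2
        · simpa using ho
        · simpa using ha
        · intro i
          simp only [Function.update_apply, reduceCtorEq, if_false, Counter.digit.injEq, true_and,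
            hg]
        · intro w' hw'
          have : w' ≠ w := fun e => hw (e ▸ hw')
          simp [this, hd w' (by simp [hw'])]
        · intro w' hw'
          have : w' ≠ w := fun e => hw (e ▸ hw')
          simp [this, hb w' (by simp [hw'])]
        · intro f hf c' hc' hc''
          refine hp f ?_ c' ((agreeOff_update b c (some w) a j).trans hc') hc''
          rw [digitFunctions, List.mem_flatMap]
          exact ⟨a, by simpa [ho] using han, hf⟩)
    intro x
    have h' := h x
    simp only [ho] at h'
    beta_reduce
    rw [digitFunctions, List.foldl_flatMap]
    refine h'.mono ?_
    simp only [List.length_cons, loopTime]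
    gcongr

omit [DecidableEq V] in
theorem setTag_setTag (t t' : Option V) (v : Var V) :
    setTag b t (setTag b t' v) = setTag b t v := by
  simp [setTag]

/-- The time for a loop over the vertices of the constructed graph. -/
def verticesTime (q r s T : ℕ) : ℕ :=
  (1 + (s + 1) * (T + 9)) + (q * (1 + (s + 1) * (loopTime s r T + 9)) + 1 + 1)

/-- The rule for loops over the vertices of the constructed graph. -/
theorem transforms_forVertices {n m : ℕ} (hn : n ≤ s) (hm : m ≤ s)
    {F : Vertex V → (Data → List Bool) → (Data → List Bool)} {q l : List V} (hl : l.Nodup)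
    (hv : v.1 b = none) {c : Counter (Option V) → ℕ} (ho : c .order = n) (hc : c .copies = m)
    (ha : c .aux = 0) (hd : ∀ i, c (.digit b i) = 0) (hb : ∀ i, c (.bound b i) = 0)
    (hp : ∀ u ∈ vertices n m q l, ∀ c', AgreeOff b c c' → (∀ i, c' (.digit b i) = u.2 i) →
      Transforms p (setTag b u.1 v) c' (F u) T) :
    Transforms (forVertices b q l p) v c
      (fun x => (vertices n m q l).foldl (fun x u => F u x) x)
      (verticesTime q.length l.length s T) := by
  have hset : setTag b none v = v := by
    rw [setTag, ← hv, Function.update_eq_self]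
  have horig : ∀ x, Does (forOriginals b p) v x c (setTag b none v)
      ((originals n).foldl (fun x u => F u x) x) c (1 + (s + 1) * (T + 9)) := by
    intro x
    refine (does_load _).seq ?_
    have h := transforms_forCounter (a := .digit b none) (b := .bound b none)
      (r := .order) (t := .aux) (p := p) (v := setTag b none v) (c := c)
      (F := fun a => F (none, Function.update 0 none a)) (T := T)
      (by simp) (by simp) (by simp) (by simp) (hd none) (hb none) ha (by
        intro a han j
        refine hp (none, Function.update 0 none a) ?_ _ (agreeOff_update b c none a j) ?_
        · exact List.mem_append_left _ (List.mem_map.mpr ⟨a, by simpa [ho] using han, rfl⟩)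
        · intro i
          simp only [Function.update_apply, reduceCtorEq, if_false, Counter.digit.injEq, true_and,
            hd, Pi.zero_apply])
    rw [originals, List.foldl_map]
    have h' := h x
    simp only [ho] at h'
    exact h'.mono (by gcongr)
  have hsat : ∀ u ∈ q, ∀ v', setTag b (some u) v' = setTag b (some u) v → ∀ x,
      Does (forSatellites b l p u) v' x c (setTag b (some u) v)
        ((satellites n m l u).foldl (fun x u => F u x) x) c
        (1 + (s + 1) * (loopTime s l.length T + 9)) := by
    intro u hu v' hv' x
    refine (does_load _).seq ?_
    rw [hv']
    have h := transforms_forCounter (a := .digit b none) (b := .bound b none)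
      (r := .copies) (t := .aux) (p := forDigits b l p) (v := setTag b (some u) v) (c := c)
      (F := fun a x => (digitFunctions n l (Function.update 0 none a)).foldl
        (fun x f => F (some u, f) x) x) (T := loopTime s l.length T)
      (by simp) (by simp) (by simp) (by simp) (hd none) (hb none) ha (by
        intro a han j
        refine transforms_forDigits (F := fun f => F (some u, f)) hn l hl _ _ ?_ ?_ ?_ ?_ ?_ ?_
        · simpa using ho
        · simpa using ha
        · intro i
          simp only [Function.update_apply, reduceCtorEq, if_false, Counter.digit.injEq, true_and,
            hd, Pi.zero_apply]
        · intro w hw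
          simp [hd]
        · intro w hw
          simp [hb]
        · intro f hf c' hc' hc''
          refine hp (some u, f) ?_ c' ((agreeOff_update b c none a j).trans hc') hc''
          refine List.mem_append_right _ (List.mem_flatMap.mpr ⟨u, hu, ?_⟩)
          exact List.mem_flatMap.mpr ⟨a, by simpa [hc] using han, List.mem_map.mpr ⟨f, hf, rfl⟩⟩)
    rw [satellites, List.foldl_flatMap]
    simp only [List.foldl_map]
    have h' := h x
    simp only [hc] at h'
    exact h'.mono (by gcongr)
  have hsats : ∀ q' : List V, (∀ u ∈ q', u ∈ q) → ∀ v', setTag b none v' = v → ∀ x,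
      ∃ v'', setTag b none v'' = v ∧
      Does (seqList (q'.map (forSatellites b l p))) v' x c v''
        ((q'.flatMap (satellites n m l)).foldl (fun x u => F u x) x) c
        (q'.length * (1 + (s + 1) * (loopTime s l.length T + 9)) + 1) := by
    intro q'
    induction q' with
    | nil =>
      intro _ v' hv' x
      exact ⟨v', hv', by simpa [seqList] using does_skip⟩
    | cons u q' ih =>
      intro hq v' hv' x
      have h1 := hsat u (hq u (by simp)) v' (by rw [← hv', setTag_setTag]) x
      obtain ⟨v'', hv'', h2⟩ := ih (fun u hu => hq u (by simp [hu])) (setTag b (some u) v)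
        (by rw [setTag_setTag, hset]) ((satellites n m l u).foldl (fun x u => F u x) x)
      refine ⟨v'', hv'', ?_⟩
      rw [List.flatMap_cons, List.foldl_append]
      exact (h1.seq h2).mono (by rw [List.length_cons, Nat.add_mul q'.length 1]; omega)
  intro x
  obtain ⟨v'', hv'', h⟩ := hsats q (fun _ h => h) (setTag b none v) (by rw [setTag_setTag, hset])
    ((originals n).foldl (fun x u => F u x) x)
  beta_reduce
  rw [vertices, List.foldl_append]
  have h3 := (horig x).seq (h.seq (does_load (setTag b none)))
  rw [hv''] at h3
  exact h3

end Loops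

/-! ### The program for the adjacency matrix -/

section Matrix

variable {V : Type} [DecidableEq V]

/-- Records in the table whether the digit `i` of the row equals the digit `j` of the column. -/
def setEq (i j : Option V) (e : Bool) (v : Var V) : Var V :=
  (v.1, Function.update v.2 i (Function.update (v.2 i) j e))

theorem setEq_setEq (i j : Option V) (e e' : Bool) (v : Var V) :
    setEq i j e (setEq i j e' v) = setEq i j e v := by
  simp [setEq]

/-- Finds out whether the digit `i` of the row equals the digit `j` of the column. Both are counted
down at the same time, and restored afterwards from the auxiliary counters. -/
def compare (i j : Option V) : Prog V :=
  .seq (.load fun _ => setEq i j true) <|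
  .seq (countdown (.digit false i) <| .seq (inc .aux) <|
    popThen (.digit true j) (inc .aux') (.load fun _ => setEq i j false)) <|
  .seq (popThen (.digit true j)
    (.seq (inc (.digit true j)) (.load fun _ => setEq i j false)) skip) <|
  .seq (moveCounter .aux (.digit false i)) (moveCounter .aux' (.digit true j))

variable {s T : ℕ}

theorem does_compare {i j : Option V} {v : Var V} {x : Data → List Bool}
    {c : Counter (Option V) → ℕ} (ha : c .aux = 0) (ha' : c .aux' = 0)
    (hi : c (.digit false i) ≤ s) :
    Does (compare i j) v x c
      (setEq i j (decide (c (.digit false i) = c (.digit true j))) v) x c (9 * s + 11) := by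
  obtain ⟨A, hA⟩ : ∃ A, A = c (.digit false i) := ⟨_, rfl⟩
  obtain ⟨B, hB⟩ : ∃ B, B = c (.digit true j) := ⟨_, rfl⟩
  -- the counters after `t` rounds of the first loop
  let Y : ℕ → Counter (Option V) → ℕ := fun t =>
    Function.update (Function.update (Function.update (Function.update c (.digit false i) (A - t))
      .aux t) (.digit true j) (B - t)) .aux' (min t B)
  have h1 := does_countdown (p := .seq (inc .aux) <|
    popThen (.digit true j) (inc .aux') (.load fun _ => setEq i j false))
    (k := .digit false i) (n := A) (T := 1 + (1 + 2)) (fun t => setEq i j (decide (t ≤ B)) v)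
    (fun _ => x) Y (by intro t _; simp [Y]) (by
      intro t ht
      refine (does_inc _).seq (does_popThen ?_ ?_)
      · intro h0
        have h0 : B - t = 0 := by simpa [Y] using h0
        convert does_load (D := Data) (C := Counter (Option V)) (setEq i j false) using 1
        · rw [setEq_setEq, decide_eq_false (by omega)]
        · funext k
          simp only [Y, Function.update_apply]
          split_ifs <;> simp_all <;> omega
      · intro h0
        have h0 : B - t ≠ 0 := by simpa [Y] using h0
        rw [decide_eq_true (show t ≤ B by omega), decide_eq_true (show t + 1 ≤ B by omega)]
        convert does_inc (D := Data) (C := Counter (Option V)) Counter.aux' using 1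
        funext k
        simp only [Y, Function.update_apply]
        split_ifs <;> simp_all <;> omega)
  have hY0 : Y 0 = c := by
    funext k
    simp only [Y, Function.update_apply]
    split_ifs <;> simp_all
  have h2 : Does (popThen (.digit true j)
      (.seq (inc (.digit true j)) (.load fun _ => setEq i j false)) skip)
      (setEq i j (decide (A ≤ B)) v) x (Y A) (setEq i j (decide (A = B)) v) x (Y A)
      ((1 + 1) + 2) := by
    refine does_popThen ?_ ?_
    · intro h0
      have h0 : B - A = 0 := by simpa [Y] using h0
      have e : decide (A ≤ B) = decide (A = B) := by
        rw [decide_eq_decide]; omega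
      rw [e]
      exact does_skip.mono (by omega)
    · intro h0
      have h0 : B - A ≠ 0 := by simpa [Y] using h0
      convert (does_inc (D := Data) (C := Counter (Option V)) (.digit true j)).seq
        (does_load (setEq i j false)) using 1
      · rw [setEq_setEq, decide_eq_false (by omega)]
      · funext k
        simp only [Y, Function.update_apply]
        split_ifs <;> simp_all
        omega
  have h3 := does_moveCounter (D := Data) (τ := Var V) (v := setEq i j (decide (A = B)) v) (x := x)
    (c := Y A) (a := .aux) (b := .digit false i) (by simp)
  have h4 := does_moveCounter (D := Data) (τ := Var V) (v := setEq i j (decide (A = B)) v) (x := x)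
    (c := Function.update (Function.update (Y A) .aux 0) (.digit false i)
      (Y A (.digit false i) + Y A .aux)) (a := .aux') (b := .digit true j) (by simp)
  have hY : Function.update (Function.update (Function.update (Function.update (Y A) .aux 0)
      (.digit false i) (Y A (.digit false i) + Y A .aux)) .aux' 0) (.digit true j)
      (Function.update (Function.update (Y A) .aux 0) (.digit false i)
        (Y A (.digit false i) + Y A .aux) (.digit true j) +
       Function.update (Function.update (Y A) .aux 0) (.digit false i)
        (Y A (.digit false i) + Y A .aux) .aux') = c := by
    funext k
    simp only [Y, Function.update_apply, reduceCtorEq, if_false, if_true, Counter.digit.injEq,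
      Bool.false_eq_true, Bool.true_eq_false, false_and, tsub_self, zero_add]
    split_ifs <;> subst_vars <;> omega
  rw [hY] at h4
  have h0 := does_load (D := Data) (C := Counter (Option V)) (x := x) (c := c) (v := v)
    (setEq i j true)
  rw [hY0, decide_eq_true (Nat.zero_le B)] at h1
  rw [← hA, ← hB]
  refine (h0.seq (h1.seq (h2.seq (h3.seq h4)))).mono ?_
  have e1 : Y A .aux = A := by simp [Y]
  have e2 : Function.update (Function.update (Y A) .aux 0) (.digit false i)
      (Y A (.digit false i) + Y A .aux) .aux' = min A B := by simp [Y]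
  rw [e2, e1]
  have := min_le_left A B
  omega

/-- Which digits of the row are equal to which digits of the column. -/
def eqTable (c : Counter (Option V) → ℕ) (i j : Option V) : Bool :=
  decide (c (.digit false i) = c (.digit true j))

theorem does_compareList {x : Data → List Bool} {c : Counter (Option V) → ℕ} (ha : c .aux = 0)
    (ha' : c .aux' = 0) (hd : ∀ i, c (.digit false i) ≤ s) (l : List (Option V × Option V))
    (v : Var V) :
    Does (seqList (l.map fun ij => compare ij.1 ij.2)) v x c
      (v.1, fun i j => if (i, j) ∈ l then eqTable c i j else v.2 i j) x c
      (l.length * (9 * s + 11) + 1) := by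
  induction l generalizing v with
  | nil => simpa [seqList] using does_skip
  | cons ij l ih =>
    have h := (does_compare (x := x) (v := v) (j := ij.2) ha ha' (hd ij.1)).seq (ih _)
    convert h.mono (n := (ij :: l).length * (9 * s + 11) + 1)
      (by rw [List.length_cons, Nat.add_mul l.length 1]; omega) using 1
    · rfl
    obtain ⟨i, j⟩ := ij
    refine Prod.ext rfl ?_
    funext i' j'
    simp only [setEq, Function.update_apply, List.mem_cons, Prod.mk.injEq, eqTable]
    by_cases h1 : (i', j') ∈ l
    · simp [h1]
    · by_cases h2 : i' = i
      · by_cases h3 : j' = j <;> simp [h2, h3]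
      · simp [h1, h2]

/-- Writes an entry of the matrix: it is copied from the input if the row and the column belong to
original vertices, and otherwise it is `bit`, a function of the tags and of the table. -/
def writeBit (bit : Var V → Bool) : Prog V :=
  .ite (fun _ v => (v.1 false).isNone && (v.1 true).isNone)
    (.seq (.pop (.inl .input)) (.push (.inl .matrix) fun o _ => o == some true))
    (.push (.inl .matrix) fun _ => bit)

/-- The effect of `writeBit` on the data stacks. -/
def writeBitEffect (bit : Var V → Bool) (v : Var V) (x : Data → List Bool) : Data → List Bool :=
  if (v.1 false).isNone && (v.1 true).isNone then
    Function.update (Function.update x .input (x .input).tail) .matrix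
      (((x .input).head? == some true) :: x .matrix)
  else Function.update x .matrix (bit v :: x .matrix)

theorem does_writeBit (bit : Var V → Bool) (v : Var V) (x : Data → List Bool)
    (c : Counter (Option V) → ℕ) :
    Does (writeBit bit) v x c v (writeBitEffect bit v x) c (2 + 1) := by
  unfold writeBit writeBitEffect
  refine does_ite (f := fun v : Var V => (v.1 false).isNone && (v.1 true).isNone) ?_ ?_
  · intro h o
    rw [if_pos h]
    have h1 := exec_pop (o := o) (v := v) (S := layout x c) (.inl Data.input)
    rw [layout_update_inl] at h1
    have h2 := exec_push (o := (layout x c (.inl Data.input)).head?) (v := v)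
      (S := layout (Function.update x .input (layout x c (.inl Data.input)).tail) c)
      (.inl Data.matrix) fun o _ => o == some true
    rw [layout_update_inl] at h2
    exact ⟨_, h1.seq h2⟩
  · intro h
    rw [if_neg (by rw [h]; simp)]
    exact (does_push _ _).mono (by omega)

variable [Fintype V]

/-- Computes the table and writes an entry of the matrix. -/
noncomputable def writeEntry (bit : Var V → Bool) : Prog V :=
  .seq (seqList ((Finset.univ : Finset (Option V × Option V)).toList.map
    fun ij => compare ij.1 ij.2)) (.seq (writeBit bit) (.load fun _ v => (v.1, fun _ _ => false)))

/-- The time for an entry, where `t` is the number of comparisons. -/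
def entryTime (t s : ℕ) : ℕ := (t * (9 * s + 11) + 1) + ((2 + 1) + 1)

theorem transforms_writeEntry (bit : Var V → Bool) {v : Var V} {c : Counter (Option V) → ℕ}
    (hv : v.2 = fun _ _ => false) (ha : c .aux = 0) (ha' : c .aux' = 0)
    (hd : ∀ i, c (.digit false i) ≤ s) :
    Transforms (writeEntry bit) v c (writeBitEffect bit (v.1, eqTable c))
      (entryTime (Fintype.card (Option V × Option V)) s) := by
  intro x
  have h := does_compareList (x := x) ha ha' hd
    (Finset.univ : Finset (Option V × Option V)).toList v
  have e : (fun i j => if (i, j) ∈ (Finset.univ : Finset (Option V × Option V)).toList then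
      eqTable c i j else v.2 i j) = eqTable c := by
    funext i j
    simp
  rw [e, Finset.length_toList, Finset.card_univ] at h
  have h' := h.seq ((does_writeBit bit _ x c).seq
    (does_load fun v : Var V => (v.1, fun _ _ => false)))
  have e' : ((v.1, fun _ _ => false) : Var V) = v := Prod.ext rfl hv.symm
  rw [e'] at h'
  exact h'

/-- The initial value of the variable. -/
def initVar (V : Type) : Var V := (fun _ => none, fun _ _ => false)

/-- What the program knows about a pair of vertices when it writes their entry. -/
def pairVar (u w : Vertex V) : Var V :=
  (fun b => if b then w.1 else u.1, fun i j => decide (u.2 i = w.2 j))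

/-- Writes the matrix, in reverse, and the number of its rows, in unary. -/
noncomputable def writeMatrix (q l : List V) (bit : Var V → Bool) : Prog V :=
  forVertices false q l
    (.seq (.push (.inl .rows) fun _ _ => true) (forVertices true q l (writeEntry bit)))

/-- The effect of `writeMatrix` on the data stacks. -/
def writeMatrixEffect (vs : List (Vertex V)) (bit : Var V → Bool) (x : Data → List Bool) :
    Data → List Bool :=
  vs.foldl (fun x u => vs.foldl (fun x w => writeBitEffect bit (pairVar u w) x)
    (Function.update x .rows (true :: x .rows))) x

/-- The time for the matrix. -/
def matrixTime (t q r s : ℕ) : ℕ := verticesTime q r s (1 + verticesTime q r s (entryTime t s))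

omit [Fintype V] in
theorem digit_le_of_mem {n m : ℕ} {q l : List V} (hn : n ≤ s) (hm : m ≤ s) {u : Vertex V}
    (hu : u ∈ vertices n m q l) (i : Option V) : u.2 i ≤ s := by
  have key : ∀ (l : List V) (g : Option V → ℕ), (∀ i, g i ≤ s) → ∀ f ∈ digitFunctions n l g,
      ∀ i, f i ≤ s := by
    intro l
    induction l with
    | nil => intro g hg f hf; simp only [digitFunctions, List.mem_singleton] at hf; rwa [hf]
    | cons w l ih =>
      intro g hg f hf
      simp only [digitFunctions, List.mem_flatMap, List.mem_range] at hf
      obtain ⟨a, ha, hf⟩ := hf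
      refine ih _ (fun i => ?_) f hf
      rw [Function.update_apply]
      split_ifs
      · omega
      · exact hg i
  simp only [vertices, originals, satellites, List.mem_append, List.mem_map, List.mem_flatMap,
    List.mem_range] at hu
  obtain ⟨a, ha, rfl⟩ | ⟨w, -, a, ha, f, hf, rfl⟩ := hu
  · simp only [Function.update_apply]
    split_ifs
    · omega
    · exact Nat.zero_le _
  · refine key l _ (fun i => ?_) f hf i
    rw [Function.update_apply]
    split_ifs
    · omega
    · exact Nat.zero_le _

theorem transforms_writeMatrix {n m : ℕ} (hn : n ≤ s) (hm : m ≤ s) {q l : List V} (hl : l.Nodup)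
    (bit : Var V → Bool) {c : Counter (Option V) → ℕ} (ho : c .order = n) (hc : c .copies = m)
    (ha : c .aux = 0) (ha' : c .aux' = 0) (hd : ∀ b i, c (.digit b i) = 0)
    (hb : ∀ b i, c (.bound b i) = 0) :
    Transforms (writeMatrix q l bit) (initVar V) c (writeMatrixEffect (vertices n m q l) bit)
      (matrixTime (Fintype.card (Option V × Option V)) q.length l.length s) := by
  refine transforms_forVertices (F := fun u x => (vertices n m q l).foldl
    (fun x w => writeBitEffect bit (pairVar u w) x) (Function.update x .rows (true :: x .rows)))
    hn hm hl rfl ho hc ha (hd _) (hb _) ?_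
  intro u hu c' hc' hu'
  have hrow := transforms_forVertices (b := true) (p := writeEntry bit)
    (v := setTag false u.1 (initVar V)) (c := c')
    (F := fun w x => writeBitEffect bit (pairVar u w) x)
    (T := entryTime (Fintype.card (Option V × Option V)) s) (q := q)
    hn hm hl rfl ((hc' _ (by simp) (by simp)).trans ho) ((hc' _ (by simp) (by simp)).trans hc)
    ((hc' _ (by simp) (by simp)).trans ha)
    (fun i => (hc' _ (by simp) (by simp)).trans (hd _ _))
    (fun i => (hc' _ (by simp) (by simp)).trans (hb _ _)) (by
      intro w hw c'' hc'' hw'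
      have hdig : ∀ i, c'' (.digit false i) = u.2 i := fun i => by
        rw [hc'' _ (by simp) (by simp), hu']
      convert transforms_writeEntry bit (s := s)
        (v := setTag true w.1 (setTag false u.1 (initVar V))) (c := c'') rfl ?_ ?_ ?_ using 2
      · refine Prod.ext ?_ ?_
        · funext b
          cases b <;> simp [pairVar, setTag]
        · funext i j
          simp only [pairVar, eqTable, hdig, hw']
      · rw [hc'' _ (by simp) (by simp), hc' _ (by simp) (by simp), ha]
      · rw [hc'' _ (by simp) (by simp), hc' _ (by simp) (by simp), ha']
      · intro i
        rw [hdig]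
        exact digit_le_of_mem hn hm hu i)
  intro x
  exact (does_push .rows fun _ => true).seq (hrow _)

end Matrix

/-! ### The program for the reduction -/

section Reduction

variable {V : Type}

/-- If the input holds the entries for pairs of original vertices, then the loop over the columns
writes a row of the matrix. -/
theorem foldl_writeBitEffect {bit : Var V → Bool} {e : Vertex V → Vertex V → Bool}
    (he : ∀ u w, ¬(u.1.isNone && w.1.isNone) → bit (pairVar u w) = e u w) (u : Vertex V)
    (ws : List (Vertex V)) (x : Data → List Bool) (rest : List Bool)
    (hx : x .input = (ws.filter fun w => u.1.isNone && w.1.isNone).map (e u) ++ rest) :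
    ws.foldl (fun x w => writeBitEffect bit (pairVar u w) x) x =
      Function.update (Function.update x .input rest) .matrix
        ((ws.map (e u)).reverse ++ x .matrix) := by
  induction ws generalizing x with
  | nil =>
    have hx : x .input = rest := by simpa using hx
    simp [← hx]
  | cons w ws ih =>
    rw [List.foldl_cons]
    by_cases h : (u.1.isNone && w.1.isNone) = true
    · rw [List.filter_cons_of_pos (p := fun w : Vertex V => u.1.isNone && w.1.isNone) h] at hx
      have e1 : writeBitEffect bit (pairVar u w) x =
          Function.update (Function.update x .input
            ((ws.filter fun w => u.1.isNone && w.1.isNone).map (e u) ++ rest)) .matrix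
            (e u w :: x .matrix) := by
        rw [writeBitEffect, if_pos (by simpa [pairVar] using h), hx]
        simp
      rw [e1, ih _ (by simp)]
      funext d
      cases d <;> simp
    · rw [List.filter_cons_of_neg (p := fun w : Vertex V => u.1.isNone && w.1.isNone) h] at hx
      have e1 : writeBitEffect bit (pairVar u w) x =
          Function.update x .matrix (e u w :: x .matrix) := by
        rw [writeBitEffect, if_neg (by simpa [pairVar] using h), he u w h]
      rw [e1, ih _ (by simpa using hx)]
      funext d
      cases d <;> simp

/-- If the input holds the entries for pairs of original vertices, then `writeMatrix` writes the
matrix with the entries `e`. -/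
theorem foldl_rows {bit : Var V → Bool} {e : Vertex V → Vertex V → Bool}
    (he : ∀ u w, ¬(u.1.isNone && w.1.isNone) → bit (pairVar u w) = e u w)
    (us ws : List (Vertex V)) (x : Data → List Bool) (rest : List Bool)
    (hx : x .input =
      us.flatMap (fun u => (ws.filter fun w => u.1.isNone && w.1.isNone).map (e u)) ++ rest) :
    us.foldl (fun x u => ws.foldl (fun x w => writeBitEffect bit (pairVar u w) x)
      (Function.update x .rows (true :: x .rows))) x =
      Function.update (Function.update (Function.update x .input rest) .matrix
        ((us.flatMap fun u => ws.map (e u)).reverse ++ x .matrix)) .rows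
        (List.replicate us.length true ++ x .rows) := by
  induction us generalizing x with
  | nil =>
    have hx : x .input = rest := by simpa using hx
    simp [← hx]
  | cons u us ih =>
    rw [List.foldl_cons, foldl_writeBitEffect he u ws _
      (us.flatMap (fun u => (ws.filter fun w => u.1.isNone && w.1.isNone).map (e u)) ++ rest)
      (by simpa using hx), ih _ (by simp)]
    funext d
    cases d <;> simp [List.replicate_succ']

variable [DecidableEq V] [Fintype V]

/-- The program that reads the order `n` and the parameter `k` of an instance, sets the number of
copies to `k + 1`, writes the matrix in reverse, and moves it to the output, in front of which it
then puts the parameter (one less than the number of copies) and the number of rows. -/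
noncomputable def construct (q l : List V) (bit : Var V → Bool) : Prog V :=
  .seq (readUnary .input .order) <|
  .seq (readUnary .input .copies) <|
  .seq (inc .copies) <|
  .seq (writeMatrix q l bit) <|
  .seq (moveData .matrix .output) <|
  .seq (.push (.inl .output) fun _ _ => false) <|
  .seq (popThen .copies skip skip) <|
  .seq (countdown .copies (.push (.inl .output) fun _ _ => true)) <|
  .seq (.push (.inl .output) fun _ _ => false) <|
  .seq (moveData .rows .output) <|
  .seq (clear .order) (.pop (.inl .input))

/-- The time for the construction, where `N` bounds the number of vertices. -/
def constructTime (t q r s N : ℕ) : ℕ :=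
  matrixTime t q r s + N * N * 2 + N * 2 + s * 10 + 20

/-- If the entries `e` agree with `bit` except for pairs of original vertices, and the input holds
the entries for these pairs, then the program outputs the matrix with the entries `e`. -/
theorem exec_construct {q l : List V} (hl : l.Nodup) {bit : Var V → Bool}
    {e : Vertex V → Vertex V → Bool}
    (he : ∀ u w, ¬(u.1.isNone && w.1.isNone) → bit (pairVar u w) = e u w) {n k s N : ℕ}
    (hn : n ≤ s) (hk : k + 1 ≤ s) {vs : List (Vertex V)} (hvs : vs = vertices n (k + 1) q l)
    (hN : vs.length ≤ N) :
    Exec (construct q l bit) none (initVar V)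
      (Function.update (fun _ => []) (.inl .input) (List.replicate n true ++ false ::
        (List.replicate k true ++ false :: vs.flatMap fun u =>
          (vs.filter fun w => u.1.isNone && w.1.isNone).map (e u))))
      none (initVar V)
      (Function.update (fun _ => []) (.inl .output) (List.replicate vs.length true ++ false ::
        (List.replicate k true ++ false :: vs.flatMap fun u => vs.map (e u))))
      (constructTime (Fintype.card (Option V × Option V)) q.length l.length s N) := by
  have hempty : ∀ (d : Data) (L : List Bool), Function.update
      (fun _ : Data ⊕ Counter (Option V) => []) (.inl d) L =
      layout (Function.update (fun _ => []) d L) fun _ => 0 := by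
    intro d L
    rw [← layout_update_inl]
    congr 1
    funext k
    cases k <;> rfl
  rw [hempty, hempty]
  obtain ⟨I, hI⟩ : ∃ I, I = vs.flatMap fun u =>
    (vs.filter fun w => u.1.isNone && w.1.isNone).map (e u) := ⟨_, rfl⟩
  obtain ⟨M, hM⟩ : ∃ M, M = vs.flatMap fun u => vs.map (e u) := ⟨_, rfl⟩
  rw [← hI, ← hM]
  have hMlen : M.length ≤ N * N := by
    rw [hM, List.length_flatMap]
    simp only [List.length_map, List.map_const', List.sum_replicate, smul_eq_mul]
    exact Nat.mul_le_mul hN hN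
  -- the counters, with the order and the number of copies as their only values
  let c : ℕ → ℕ → Counter (Option V) → ℕ := fun a b =>
    Function.update (Function.update (fun _ => 0) .order a) .copies b
  -- the data stacks
  let X : List Bool → List Bool → List Bool → List Bool → Data → List Bool := fun A B C E d =>
    match d with | .input => A | .matrix => B | .rows => C | .output => E
  have hin : ∀ L, Function.update (fun _ => []) Data.input L = X L [] [] [] := by
    intro L
    funext d
    cases d <;> rfl
  have hout : ∀ L, Function.update (fun _ => []) Data.output L = X [] [] [] L := by
    intro L
    funext d
    cases d <;> rfl
  have hc : (fun _ => 0) = c 0 0 := by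
    funext k
    cases k <;> simp [c]
  rw [hin, hout, hc]
  have h1 : Does (readUnary .input .order) (initVar V)
      (X (List.replicate n true ++ false :: (List.replicate k true ++ false :: I)) [] [] [])
      (c 0 0) (initVar V) (X (List.replicate k true ++ false :: I) [] [] []) (c n 0)
      (n * 2 + 1) :=
    (does_readUnary (n := n) (l := List.replicate k true ++ false :: I)
      (d := Data.input) (k := Counter.order) rfl).of_eq (by funext d; cases d <;> rfl) (by
        funext k
        cases k <;> simp [c])
  have h2 : Does (readUnary .input .copies) (initVar V)
      (X (List.replicate k true ++ false :: I) [] [] []) (c n 0) (initVar V)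
      (X I [] [] []) (c n k) (k * 2 + 1) :=
    (does_readUnary (n := k) (l := I) (d := Data.input)
      (k := Counter.copies) rfl).of_eq (by funext d; cases d <;> rfl) (by simp [c])
  have h3 : Does (inc .copies) (initVar V) (X I [] [] []) (c n k) (initVar V) (X I [] [] [])
      (c n (k + 1)) 1 :=
    (does_inc _).of_eq rfl (by simp [c])
  have h4 : Does (writeMatrix q l bit) (initVar V) (X I [] [] []) (c n (k + 1)) (initVar V)
      (X [] M.reverse (List.replicate vs.length true) []) (c n (k + 1))
      (matrixTime (Fintype.card (Option V × Option V)) q.length l.length s) :=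
    (transforms_writeMatrix hn hk hl bit (by simp [c]) (by simp [c]) (by simp [c]) (by simp [c])
      (by simp [c]) (by simp [c]) _).of_eq (by
        rw [← hvs, writeMatrixEffect, foldl_rows he vs vs _ [] (by simp [X, hI]), ← hM]
        funext d
        cases d <;> simp [X]) rfl
  have h5 : Does (moveData .matrix .output) (initVar V)
      (X [] M.reverse (List.replicate vs.length true) []) (c n (k + 1)) (initVar V)
      (X [] [] (List.replicate vs.length true) M) (c n (k + 1)) (M.reverse.length * 2 + 1) :=
    (does_moveData (by simp)).of_eq (by funext d; cases d <;> simp [X]) rfl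
  have h6 : Does (.push (.inl .output) fun _ _ => false) (initVar V)
      (X [] [] (List.replicate vs.length true) M) (c n (k + 1)) (initVar V)
      (X [] [] (List.replicate vs.length true) (false :: M)) (c n (k + 1)) 1 :=
    (does_push _ _).of_eq (by funext d; cases d <;> simp [X]) rfl
  have h7 : Does (popThen .copies skip skip) (initVar V)
      (X [] [] (List.replicate vs.length true) (false :: M)) (c n (k + 1)) (initVar V)
      (X [] [] (List.replicate vs.length true) (false :: M)) (c n k) (1 + 2) :=
    does_popThen (fun h => by simp [c] at h) fun _ => by
      rw [show Function.update (c n (k + 1)) .copies (c n (k + 1) .copies - 1) = c n k by simp [c]]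
      exact does_skip
  have h8 : Does (countdown .copies (.push (.inl .output) fun _ _ => true)) (initVar V)
      (X [] [] (List.replicate vs.length true) (false :: M)) (c n k) (initVar V)
      (X [] [] (List.replicate vs.length true) (List.replicate k true ++ false :: M)) (c n 0)
      (k * (1 + 1) + 1) := by
    have h := does_countdown (D := Data) (τ := Var V) (k := (Counter.copies : Counter (Option V)))
      (n := k) (T := 1) (p := .push (.inl .output) fun _ _ => true) (fun _ => initVar V)
      (fun i => X [] [] (List.replicate vs.length true) (List.replicate i true ++ false :: M))
      (fun i => c n (k - i)) (by simp [c]) (by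
        intro i _
        have e : Function.update (c n (k - i)) .copies (k - (i + 1)) = c n (k - (i + 1)) := by
          simp [c]
        rw [e]
        exact (does_push _ _).of_eq (by funext d; cases d <;> simp [X, List.replicate_succ]) rfl)
    simpa using h
  have h9 : Does (.push (.inl .output) fun _ _ => false) (initVar V)
      (X [] [] (List.replicate vs.length true) (List.replicate k true ++ false :: M)) (c n 0)
      (initVar V) (X [] [] (List.replicate vs.length true)
        (false :: (List.replicate k true ++ false :: M))) (c n 0) 1 :=
    (does_push _ _).of_eq (by funext d; cases d <;> simp [X]) rfl
  have h10 : Does (moveData .rows .output) (initVar V)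
      (X [] [] (List.replicate vs.length true) (false :: (List.replicate k true ++ false :: M)))
      (c n 0) (initVar V) (X [] [] [] (List.replicate vs.length true ++
        false :: (List.replicate k true ++ false :: M))) (c n 0)
      ((List.replicate vs.length true).length * 2 + 1) :=
    (does_moveData (by simp)).of_eq (by funext d; cases d <;> simp [X]) rfl
  have h11 : Does (clear .order) (initVar V) (X [] [] [] (List.replicate vs.length true ++
        false :: (List.replicate k true ++ false :: M))) (c n 0) (initVar V)
      (X [] [] [] (List.replicate vs.length true ++
        false :: (List.replicate k true ++ false :: M))) (c 0 0) (n * 2 + 1) := by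
    refine Does.mono ((does_clear _).of_eq rfl ?_) (by simp [c])
    funext k
    cases k <;> simp [c]
  have h12 : ∀ o, Exec (.pop (.inl .input)) o (initVar V) (layout (X [] [] []
      (List.replicate vs.length true ++ false :: (List.replicate k true ++ false :: M))) (c 0 0))
      none (initVar V) (layout (X [] [] []
      (List.replicate vs.length true ++ false :: (List.replicate k true ++ false :: M))) (c 0 0))
      1 := by
    intro o
    have h := exec_pop (o := o) (v := initVar V) (S := layout (X [] [] []
      (List.replicate vs.length true ++ false :: (List.replicate k true ++ false :: M))) (c 0 0))
      (.inl Data.input)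
    rw [layout_update_inl] at h
    convert h using 2
    · rfl
    · funext d
      cases d <;> rfl
  obtain ⟨o₁, h1⟩ := h1 none
  obtain ⟨o₂, h2⟩ := h2 o₁
  obtain ⟨o₃, h3⟩ := h3 o₂
  obtain ⟨o₄, h4⟩ := h4 o₃
  obtain ⟨o₅, h5⟩ := h5 o₄
  obtain ⟨o₆, h6⟩ := h6 o₅
  obtain ⟨o₇, h7⟩ := h7 o₆
  obtain ⟨o₈, h8⟩ := h8 o₇
  obtain ⟨o₉, h9⟩ := h9 o₈
  obtain ⟨o₁₀, h10⟩ := h10 o₉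
  obtain ⟨o₁₁, h11⟩ := h11 o₁₀
  refine (h1.seq (h2.seq (h3.seq (h4.seq (h5.seq (h6.seq (h7.seq (h8.seq (h9.seq (h10.seq
    (h11.seq (h12 _)))))))))))).mono ?_
  rw [List.length_reverse, List.length_replicate, constructTime]
  omega

end Reduction

/-! ### The constructed graph -/

section Graph

variable {V : Type} (H : SimpleGraph V) (P : Finset V) {n : ℕ}

/-- Adjacency of vertices with the tags `s` and `t`, not both of them original, where `E i j` says
that the digit `i` of the first vertex equals the digit `j` of the second one. The graph induced by
a copy and the original vertices to which it is attached is a copy of `H`, except for the edges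
between original vertices. -/
def newAdj (s t : Option V) (E : Option V → Option V → Prop) : Prop :=
  match s, t with
  | none, none => False
  | some u, none => ∃ w ∈ P, H.Adj u w ∧ E (some w) none
  | none, some u => ∃ w ∈ P, H.Adj u w ∧ E none (some w)
  | some u, some u' => H.Adj u u' ∧ E none none ∧ ∀ w ∈ P, E (some w) (some w)

/-- Adjacency in the constructed graph. -/
def vertexAdj (G : SimpleGraph (Fin n)) (u w : Vertex V) : Prop :=
  newAdj H P u.1 w.1 (fun i j => u.2 i = w.2 j) ∨
    (u.1 = none ∧ w.1 = none ∧ ∃ x y, G.Adj x y ∧ u.2 none = x ∧ w.2 none = y)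

variable {H P}

theorem vertexAdj_symm {G : SimpleGraph (Fin n)} {u w : Vertex V} (h : vertexAdj H P G u w) :
    vertexAdj H P G w u := by
  obtain ⟨s, f⟩ := u
  obtain ⟨t, g⟩ := w
  obtain h | ⟨h1, h2, x, y, h, hx, hy⟩ := h
  · left
    rcases s with _ | u <;> rcases t with _ | u'
    · exact h
    · obtain ⟨w, hw, h, h'⟩ := h
      exact ⟨w, hw, h, h'.symm⟩
    · obtain ⟨w, hw, h, h'⟩ := h
      exact ⟨w, hw, h, h'.symm⟩
    · exact ⟨h.1.symm, h.2.1.symm, fun w hw => (h.2.2 w hw).symm⟩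
  · exact .inr ⟨h2, h1, y, x, h.symm, hy, hx⟩

theorem not_vertexAdj_self (G : SimpleGraph (Fin n)) (u : Vertex V) : ¬vertexAdj H P G u u := by
  obtain ⟨s, f⟩ := u
  rintro (h | ⟨h1, -, x, y, h, hx, hy⟩)
  · rcases s with _ | u
    · exact h
    · exact H.loopless.irrefl u h.1
  · have e : x = y := Fin.ext (hx.symm.trans hy)
    exact G.loopless.irrefl x (e ▸ h)

variable (H P) in
/-- The graph constructed from `G`, on the positions of a list of vertices. -/
def attach (G : SimpleGraph (Fin n)) (vs : List (Vertex V)) : SimpleGraph (Fin vs.length) where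
  Adj i j := vertexAdj H P G vs[i] vs[j]
  symm := ⟨fun _ _ h => vertexAdj_symm h⟩
  loopless := ⟨fun _ => not_vertexAdj_self G _⟩

variable [DecidableEq V]

theorem mem_digitFunctions {l : List V} (hl : l.Nodup) {g f : Option V → ℕ} :
    f ∈ digitFunctions n l g ↔
      (∀ w ∈ l, f (some w) < n) ∧ ∀ i, (∀ w ∈ l, i ≠ some w) → f i = g i := by
  induction l generalizing g with
  | nil => simp [digitFunctions, funext_iff]
  | cons w l ih =>
    have hw : w ∉ l := (List.nodup_cons.mp hl).1
    simp only [digitFunctions, List.mem_flatMap, List.mem_range, ih (List.nodup_cons.mp hl).2]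
    constructor
    · rintro ⟨a, ha, h1, h2⟩
      have hfw : f (some w) = a := by
        rw [h2 (some w) fun w' hw' e => hw (by rwa [Option.some_inj.mp e]), Function.update_self]
      refine ⟨?_, fun i hi => ?_⟩
      · intro w' hw'
        rcases List.mem_cons.mp hw' with rfl | hw'
        · rwa [hfw]
        · exact h1 w' hw'
      · rw [h2 i fun w' hw' => hi w' (List.mem_cons_of_mem _ hw'),
          Function.update_of_ne (hi w List.mem_cons_self)]
    · rintro ⟨h1, h2⟩
      refine ⟨f (some w), h1 w List.mem_cons_self, fun w' hw' => h1 w' (List.mem_cons_of_mem _ hw'),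
        fun i hi => ?_⟩
      by_cases hiw : i = some w
      · rw [hiw, Function.update_self]
      · rw [Function.update_of_ne hiw]
        refine h2 i fun w' hw' => ?_
        rcases List.mem_cons.mp hw' with rfl | hw'
        · exact hiw
        · exact hi w' hw'

theorem nodup_digitFunctions {l : List V} (hl : l.Nodup) (g : Option V → ℕ) :
    (digitFunctions n l g).Nodup := by
  induction l generalizing g with
  | nil => simp [digitFunctions]
  | cons w l ih =>
    have hw : w ∉ l := (List.nodup_cons.mp hl).1
    rw [digitFunctions, List.nodup_flatMap]
    refine ⟨fun a _ => ih (List.nodup_cons.mp hl).2 _, ?_⟩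
    refine List.nodup_range.imp ?_
    intro a b hab f hfa hfb
    have h1 := ((mem_digitFunctions (List.nodup_cons.mp hl).2).mp hfa).2 (some w)
      fun w' hw' e => hw (by rwa [Option.some_inj.mp e])
    have h2 := ((mem_digitFunctions (List.nodup_cons.mp hl).2).mp hfb).2 (some w)
      fun w' hw' e => hw (by rwa [Option.some_inj.mp e])
    rw [Function.update_self] at h1 h2
    exact hab (h1.symm.trans h2)

theorem length_digitFunctions (l : List V) (g : Option V → ℕ) :
    (digitFunctions n l g).length = n ^ l.length := by
  induction l generalizing g with
  | nil => simp [digitFunctions]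
  | cons w l ih => simp [digitFunctions, List.length_flatMap, ih, pow_succ']

/-- The original vertex with number `a`. -/
def original (a : ℕ) : Vertex V := (none, Function.update 0 none a)

theorem mem_vertices {m : ℕ} {q l : List V} (hl : l.Nodup) {u : Vertex V} :
    u ∈ vertices n m q l ↔ (∃ a < n, u = original a) ∨ ∃ w ∈ q, u.1 = some w ∧ u.2 none < m ∧
      (∀ w ∈ l, u.2 (some w) < n) ∧ ∀ w ∉ l, u.2 (some w) = 0 := by
  obtain ⟨t, f⟩ := u
  rw [vertices, List.mem_append]
  refine or_congr ?_ ?_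
  · simp only [originals, List.mem_map, List.mem_range, original]
    exact exists_congr fun a => and_congr_right fun _ => eq_comm
  · simp only [satellites, List.mem_flatMap, List.mem_map, List.mem_range, mem_digitFunctions hl,
      Prod.mk.injEq]
    constructor
    · rintro ⟨w, hw, a, ha, f', ⟨h1, h2⟩, rfl, rfl⟩
      refine ⟨w, hw, rfl, ?_, h1, fun w' hw' => ?_⟩
      · rw [h2 none fun w' _ => by simp, Function.update_self]
        exact ha
      · rw [h2 (some w') fun w'' hw'' e => hw' (by rwa [Option.some_inj.mp e]),
          Function.update_of_ne (by simp), Pi.zero_apply]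
    · rintro ⟨w, hw, rfl, h0, h1, h2⟩
      refine ⟨w, hw, f none, h0, f, ⟨h1, fun i hi => ?_⟩, rfl, rfl⟩
      rcases i with _ | w'
      · rw [Function.update_self]
      · rw [Function.update_of_ne (by simp), Pi.zero_apply, h2 w' fun h => hi w' h rfl]

theorem nodup_vertices (n m : ℕ) {q l : List V} (hq : q.Nodup) (hl : l.Nodup) :
    (vertices n m q l).Nodup := by
  rw [vertices, List.nodup_append']
  refine ⟨List.Nodup.map ?_ List.nodup_range, ?_, ?_⟩
  · intro a b h
    have := congrFun (Prod.mk.inj h).2 none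
    simpa using this
  · rw [List.nodup_flatMap]
    refine ⟨fun u _ => ?_, hq.imp ?_⟩
    · rw [satellites, List.nodup_flatMap]
      refine ⟨fun a _ => (nodup_digitFunctions hl _).map fun f g h => (Prod.mk.inj h).2,
        List.nodup_range.imp ?_⟩
      intro a b hab u hua hub
      obtain ⟨f, hf, rfl⟩ := List.mem_map.mp hua
      obtain ⟨f', hf', e⟩ := List.mem_map.mp hub
      obtain rfl := (Prod.mk.inj e).2
      have h1 := ((mem_digitFunctions hl).mp hf).2 none fun w _ => by simp
      have h2 := ((mem_digitFunctions hl).mp hf').2 none fun w _ => by simp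
      rw [Function.update_self] at h1 h2
      exact hab (h1.symm.trans h2)
    · intro u u' huu' w hw hw'
      simp only [satellites, List.mem_flatMap, List.mem_map] at hw hw'
      obtain ⟨_, _, _, _, rfl⟩ := hw
      obtain ⟨_, _, _, _, e⟩ := hw'
      exact huu' (Option.some_inj.mp (Prod.mk.inj e).1).symm
  · intro u hu hu'
    simp only [originals, satellites, List.mem_flatMap, List.mem_map] at hu hu'
    obtain ⟨_, _, rfl⟩ := hu
    obtain ⟨_, _, _, _, _, _, e⟩ := hu'
    simp at e

theorem length_vertices (n m : ℕ) (q l : List V) :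
    (vertices n m q l).length = n + q.length * (m * n ^ l.length) := by
  simp [vertices, originals, satellites, List.length_flatMap, length_digitFunctions]

end Graph

/-! ### Correctness of the construction -/

section Correctness

variable {V : Type} [DecidableEq V] [Fintype V] {H : SimpleGraph V} {P : Finset V} {n m : ℕ}
  {G : SimpleGraph (Fin n)}

variable (P n m) in
/-- The vertices of the constructed graph, for the set `P` of vertices of `H`. -/
noncomputable def vertexList : List (Vertex V) := vertices n m Pᶜ.toList P.toList

theorem nodup_vertexList : (vertexList P n m).Nodup :=
  nodup_vertices n m (Finset.nodup_toList _) (Finset.nodup_toList _)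

theorem mem_vertexList {u : Vertex V} :
    u ∈ vertexList P n m ↔ (∃ a < n, u = original a) ∨ ∃ w ∉ P, u.1 = some w ∧ u.2 none < m ∧
      (∀ w ∈ P, u.2 (some w) < n) ∧ ∀ w ∉ P, u.2 (some w) = 0 := by
  rw [vertexList, mem_vertices (Finset.nodup_toList _)]
  simp

theorem exists_position (P : Finset V) (n m : ℕ) (x : Fin n) :
    ∃ i : Fin (vertexList P n m).length, (vertexList P n m)[i] = original (x : ℕ) := by
  obtain ⟨i, hi, h⟩ := List.mem_iff_getElem.mp
    ((mem_vertexList (P := P) (m := m)).mpr (.inl ⟨x, x.2, rfl⟩))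
  exact ⟨⟨i, hi⟩, h⟩

variable (P n m) in
/-- The position of an original vertex. -/
noncomputable def position (x : Fin n) : Fin (vertexList P n m).length :=
  (exists_position P n m x).choose

theorem getElem_position (x : Fin n) : (vertexList P n m)[position P n m x] = original (x : ℕ) :=
  (exists_position P n m x).choose_spec

theorem getElem_vertexList_injective {i j : Fin (vertexList P n m).length}
    (h : (vertexList P n m)[i] = (vertexList P n m)[j]) : i = j :=
  Fin.ext ((nodup_vertexList.getElem_inj_iff).mp h)

omit [Fintype V] in
theorem original_injective {a b : ℕ} (h : (original a : Vertex V) = original b) : a = b := by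
  simpa using congrFun (Prod.mk.inj h).2 none

theorem position_injective : Function.Injective (position P n m) := by
  intro x y h
  exact Fin.ext (original_injective ((getElem_position x).symm.trans
    ((congrArg (fun i => (vertexList P n m)[i]) h).trans (getElem_position y))))

theorem attach_adj_position (x y : Fin n) :
    (attach H P G (vertexList P n m)).Adj (position P n m x) (position P n m y) ↔ G.Adj x y := by
  change vertexAdj H P G _ _ ↔ _
  rw [getElem_position, getElem_position]
  simp only [vertexAdj, newAdj, original, true_and, false_or, Function.update_self]
  constructor
  · rintro ⟨x', y', h, hx, hy⟩
    rwa [Fin.ext hx, Fin.ext hy]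
  · exact fun h => ⟨x, y, h, rfl, rfl⟩

/-- A new vertex that imitates `u` has at most as many neighbours as `u`, so an induced copy of `H`
cannot use it for a vertex of larger degree. -/
theorem exists_position_eq [DecidableRel H.Adj] {d : ℤ}
    (hP : ∀ v, v ∈ P ↔ d < (H.degree v : ℤ)) (v : V) (hv : v ∈ P)
    {F : Set (Sym2 (Fin (vertexList P n m).length))}
    (φ : H ↪g (attach H P G (vertexList P n m)).deleteEdges F) :
    ∃ x, φ v = position P n m x := by
  obtain ⟨a, ha, h⟩ | ⟨u, hu, htag, -, -, hzero⟩ :=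
    mem_vertexList.mp (List.getElem_mem (φ v).isLt)
  · refine ⟨⟨a, ha⟩, getElem_vertexList_injective ?_⟩
    rw [getElem_position]
    exact h
  · exfalso
    obtain ⟨t, f, hvf⟩ : ∃ t f, (vertexList P n m)[φ v] = (t, f) := ⟨_, _, rfl⟩
    have hvf' : (vertexList P n m)[(φ v : ℕ)] = (t, f) := hvf
    rw [hvf'] at htag hzero
    dsimp only at htag hzero
    subst htag
    let τ : V → Vertex V := fun w => if w ∈ P then original (f (some w)) else (some w, f)
    have hcard : H.degree v ≤ H.degree u := by
      rw [← H.card_neighborFinset_eq_degree u]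
      refine le_trans ?_ (Finset.card_image_le (f := τ))
      rw [← H.card_neighborFinset_eq_degree v]
      refine Finset.card_le_card_of_injOn (fun w => (vertexList P n m)[φ w]) ?_ ?_
      · intro w hw
        have hvw : vertexAdj H P G (vertexList P n m)[φ v] (vertexList P n m)[φ w] :=
          (SimpleGraph.deleteEdges_adj.mp (φ.map_adj_iff.mpr
            ((H.mem_neighborFinset v w).mp hw))).1
        rw [hvf] at hvw
        simp only [Finset.coe_image, Set.mem_image, Finset.mem_coe, SimpleGraph.mem_neighborFinset]
        obtain h | ⟨h, -⟩ := hvw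
        · obtain ⟨a, ha, e⟩ | ⟨u', hu', htag', -, -, hzero'⟩ :=
            mem_vertexList.mp (List.getElem_mem (φ w).isLt)
          · have e' : (vertexList P n m)[φ w] = original a := e
            rw [e'] at h ⊢
            obtain ⟨w', hw', hadj, hfw⟩ := h
            refine ⟨w', hadj, ?_⟩
            simp only [τ, if_pos hw']
            refine congrArg original (hfw.trans ?_)
            simp [original]
          · obtain ⟨t', f', hwf⟩ : ∃ t' f', (vertexList P n m)[φ w] = (t', f') := ⟨_, _, rfl⟩
            have hwf' : (vertexList P n m)[(φ w : ℕ)] = (t', f') := hwf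
            rw [hwf'] at htag' hzero'
            dsimp only at htag' hzero'
            subst htag'
            rw [hwf] at h
            obtain ⟨hadj, h0, h1⟩ := h
            refine ⟨u', hadj, ?_⟩
            simp only [τ, if_neg hu']
            change (some u', f) = (vertexList P n m)[φ w]
            rw [hwf]
            refine Prod.ext rfl (funext fun i => ?_)
            rcases i with _ | w'
            · exact h0
            · by_cases hw' : w' ∈ P
              · exact h1 w' hw'
              · exact (hzero w' hw').trans (hzero' w' hw').symm
        · simp at h
      · intro w _ w' _ h
        exact φ.injective (getElem_vertexList_injective h)
    have h1 := (hP v).mp hv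
    have h2 := mt (hP u).mpr hu
    omega

theorem isYes_attach [DecidableRel H.Adj] {d : ℤ} (hP : ∀ v, v ∈ P ↔ d < (H.degree v : ℤ)) {k : ℕ}
    (h : (freeEdgeDeletion (H.induce (P : Set V))).IsYes ⟨n, G, k⟩) :
    (freeEdgeDeletion H).IsYes ⟨_, attach H P G (vertexList P n m), k⟩ := by
  classical
  obtain ⟨F, hF, hFk, hfree⟩ := h
  dsimp only at F hF hFk hfree
  refine ⟨F.image (Sym2.map (position P n m)), ?_, Finset.card_image_le.trans hFk, ?_⟩
  · intro e he
    obtain ⟨e', he', rfl⟩ := Finset.mem_image.mp (Finset.mem_coe.mp he)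
    induction e' with | _ x y =>
    exact (attach_adj_position x y).mpr (G.mem_edgeSet.mp (hF (Finset.mem_coe.mpr he')))
  · rintro ⟨φ⟩
    refine hfree ?_
    choose x hx using fun v : ↥(P : Set V) => exists_position_eq hP v.1 v.2 φ
    refine ⟨⟨⟨x, fun v w hvw => ?_⟩, fun {v w} => ?_⟩⟩
    · refine Subtype.ext (φ.injective ?_)
      rw [hx v, hx w, hvw]
    · change (G.deleteEdges (F : Set _)).Adj (x v) (x w) ↔ H.Adj v w
      rw [← φ.map_adj_iff, hx v, hx w, SimpleGraph.deleteEdges_adj, SimpleGraph.deleteEdges_adj,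
        attach_adj_position]
      have e : s(position P n m (x v), position P n m (x w)) =
          Sym2.map (position P n m) s(x v, x w) := rfl
      rw [e, Finset.coe_image,
        (Sym2.map.injective (position_injective (P := P) (n := n) (m := m))).mem_set_image]

/-- The vertex in the copy with number `a`, attached at the images of the vertices in `P` under
`x`. -/
def copyVertex (a : ℕ) (x : ↥(P : Set V) → Fin n) (w : V) : Vertex V :=
  if h : w ∈ P then original (x ⟨w, h⟩ : ℕ) else
    (some w, fun i => i.elim a fun v => if h : v ∈ P then (x ⟨v, h⟩ : ℕ) else 0)

theorem copyVertex_mem {a : ℕ} (ha : a < m) (x : ↥(P : Set V) → Fin n) (w : V) :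
    copyVertex a x w ∈ vertexList P n m := by
  rw [mem_vertexList, copyVertex]
  split_ifs with h
  · exact .inl ⟨_, (x ⟨w, h⟩).2, rfl⟩
  · refine .inr ⟨w, h, rfl, ha, fun v hv => ?_, fun v hv => ?_⟩
    · simp [hv]
    · simp [hv]

omit [Fintype V] in
theorem copyVertex_injective {a : ℕ} {x : ↥(P : Set V) → Fin n} (hx : Function.Injective x) :
    Function.Injective (copyVertex a x) := by
  intro v w h
  simp only [copyVertex] at h
  split_ifs at h with h1 h2 h2
  · simpa using hx (Fin.ext (original_injective h))
  · exact absurd (Prod.mk.inj h).1 (by simp)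
  · exact absurd (Prod.mk.inj h).1 (by simp)
  · simpa using (Prod.mk.inj h).1

omit [Fintype V] in
theorem vertexAdj_copyVertex {a : ℕ} {x : ↥(P : Set V) → Fin n} (hx : Function.Injective x)
    {v w : V} (hvw : ¬(v ∈ P ∧ w ∈ P)) :
    vertexAdj H P G (copyVertex a x v) (copyVertex a x w) ↔ H.Adj v w := by
  have key : ∀ v ∉ P, ∀ w,
      (vertexAdj H P G (copyVertex a x v) (copyVertex a x w) ↔ H.Adj v w) := by
    intro v hv w
    by_cases hw : w ∈ P
    · simp only [copyVertex, dif_neg hv, dif_pos hw, vertexAdj, newAdj, original, reduceCtorEq,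
        false_and, or_false, Option.elim_some, Function.update_self]
      constructor
      · rintro ⟨w', hw', h, e⟩
        rw [dif_pos hw'] at e
        have := hx (Fin.ext e)
        rw [Subtype.mk.injEq] at this
        rwa [← this]
      · intro h
        exact ⟨w, hw, h, by rw [dif_pos hw]⟩
    · simp [copyVertex, hv, hw, vertexAdj, newAdj]
  by_cases hv : v ∈ P
  · have hw : w ∉ P := fun hw => hvw ⟨hv, hw⟩
    rw [H.adj_comm, ← key w hw v]
    exact ⟨vertexAdj_symm, vertexAdj_symm⟩
  · exact key v hv w

/-- Copies with different numbers have no edges in common, apart from those between original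
vertices. So a set of at most `k` edges meets at most `k` of `k + 1` copies. -/
theorem isYes_of_isYes_attach {k : ℕ}
    (h : (freeEdgeDeletion H).IsYes ⟨_, attach H P G (vertexList P n (k + 1)), k⟩) :
    (freeEdgeDeletion (H.induce (P : Set V))).IsYes ⟨n, G, k⟩ := by
  classical
  obtain ⟨F, hF, hFk, hfree⟩ := h
  dsimp only at F hF hFk hfree
  refine ⟨Finset.univ.filter fun e => e ∈ G.edgeSet ∧ Sym2.map (position P n (k + 1)) e ∈ F,
    fun e he => ?_, le_trans ?_ hFk, ?_⟩
  · simp only [Finset.coe_filter, Finset.mem_univ, true_and, Set.mem_ofPred_eq] at he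
    exact he.1
  · refine Finset.card_le_card_of_injOn (Sym2.map (position P n (k + 1))) ?_
      (Sym2.map.injective position_injective).injOn
    intro e he
    simp only [Finset.coe_filter, Finset.mem_univ, true_and, Set.mem_ofPred_eq] at he
    exact he.2
  · rintro ⟨ψ⟩
    have hpos : ∀ a : Fin (k + 1), ∀ w, ∃ i : Fin (vertexList P n (k + 1)).length,
        (vertexList P n (k + 1))[i] = copyVertex a ψ w := by
      intro a w
      obtain ⟨i, hi, h⟩ := List.mem_iff_getElem.mp (copyVertex_mem a.2 ψ w)
      exact ⟨⟨i, hi⟩, h⟩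
    choose φ hφ using hpos
    have hinj : ∀ a, Function.Injective (φ a) := by
      intro a v w h
      refine copyVertex_injective (a := a) ψ.injective ?_
      rw [← hφ, ← hφ, h]
    have hbad : ∀ a, ∃ v w, ¬(v ∈ P ∧ w ∈ P) ∧ s(φ a v, φ a w) ∈ F := by
      intro a
      by_contra! hgood
      refine hfree ⟨⟨⟨φ a, hinj a⟩, fun {v w} => ?_⟩⟩
      change ((attach H P G (vertexList P n (k + 1))).deleteEdges (F : Set _)).Adj
        (φ a v) (φ a w) ↔ H.Adj v w
      by_cases hvw : v ∈ P ∧ w ∈ P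
      · obtain ⟨hv, hw⟩ := hvw
        have hp : ∀ v (hv : v ∈ P), φ a v = position P n (k + 1) (ψ ⟨v, hv⟩) := by
          intro v hv
          refine getElem_vertexList_injective ?_
          rw [hφ, getElem_position, copyVertex, dif_pos hv]
        have := ψ.map_adj_iff (v := ⟨v, hv⟩) (w := ⟨w, hw⟩)
        rw [SimpleGraph.comap_adj] at this
        refine Iff.trans ?_ this
        rw [hp v hv, hp w hw, SimpleGraph.deleteEdges_adj, SimpleGraph.deleteEdges_adj,
          attach_adj_position]
        refine and_congr_right fun hadj => not_congr ?_
        simp [hadj]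
      · rw [SimpleGraph.deleteEdges_adj]
        have h1 : (attach H P G (vertexList P n (k + 1))).Adj (φ a v) (φ a w) ↔ H.Adj v w := by
          change vertexAdj H P G _ _ ↔ _
          rw [hφ, hφ]
          exact vertexAdj_copyVertex ψ.injective hvw
        rw [h1]
        exact ⟨fun h => h.1, fun h => ⟨h, hgood v w (by simpa using hvw)⟩⟩
    choose v w hvw he using hbad
    have hcard : Fintype.card (Fin (k + 1)) ≤ F.card := by
      rw [← Finset.card_univ]
      refine Finset.card_le_card_of_injOn (fun a => s(φ a (v a), φ a (w a))) (fun a _ => he a) ?_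
      intro a _ b _ hab
      -- the digit `none` of a new vertex on the edge is the number of the copy
      have hnum : ∀ (a : Fin (k + 1)) i, i ∈ s(φ a (v a), φ a (w a)) →
          (vertexList P n (k + 1))[i].1 ≠ none → (vertexList P n (k + 1))[i].2 none = a := by
        intro a i hi hne
        have hcopy : ∀ u, (copyVertex a ψ u).1 ≠ none → (copyVertex a ψ u).2 none = a := by
          intro u hu
          by_cases h : u ∈ P
          · simp [copyVertex, h, original] at hu
          · simp [copyVertex, h]
        rcases Sym2.mem_iff.mp hi with rfl | rfl
        · rw [hφ] at hne ⊢
          exact hcopy _ hne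
        · rw [hφ] at hne ⊢
          exact hcopy _ hne
      have hnew : ∃ i ∈ s(φ a (v a), φ a (w a)), (vertexList P n (k + 1))[i].1 ≠ none := by
        by_cases hv : v a ∈ P
        · have hw : w a ∉ P := fun hw => hvw a ⟨hv, hw⟩
          exact ⟨_, Sym2.mem_mk_right _ _, by rw [hφ]; simp [copyVertex, hw]⟩
        · exact ⟨_, Sym2.mem_mk_left _ _, by rw [hφ]; simp [copyVertex, hv]⟩
      obtain ⟨i, hi, hne⟩ := hnew
      refine Fin.ext ((hnum a i hi hne).symm.trans (hnum b i ?_ hne))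
      dsimp only at hab
      rwa [← hab]
    rw [Fintype.card_fin] at hcard
    omega

end Correctness

/-! ### The running time -/

/-- The functions which are given by a polynomial. -/
def IsPolynomial (f : ℕ → ℕ) : Prop := ∃ p : Polynomial ℕ, ∀ s, f s = p.eval s

theorem isPolynomial_const (a : ℕ) : IsPolynomial fun _ => a := ⟨Polynomial.C a, by simp⟩

theorem isPolynomial_id : IsPolynomial fun s => s := ⟨Polynomial.X, by simp⟩

theorem IsPolynomial.add {f g : ℕ → ℕ} (hf : IsPolynomial f) (hg : IsPolynomial g) :
    IsPolynomial fun s => f s + g s := by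
  obtain ⟨p, hp⟩ := hf
  obtain ⟨q, hq⟩ := hg
  exact ⟨p + q, by simp [hp, hq]⟩

theorem IsPolynomial.mul {f g : ℕ → ℕ} (hf : IsPolynomial f) (hg : IsPolynomial g) :
    IsPolynomial fun s => f s * g s := by
  obtain ⟨p, hp⟩ := hf
  obtain ⟨q, hq⟩ := hg
  exact ⟨p * q, by simp [hp, hq]⟩

theorem IsPolynomial.pow {f : ℕ → ℕ} (hf : IsPolynomial f) (a : ℕ) :
    IsPolynomial fun s => f s ^ a := by
  obtain ⟨p, hp⟩ := hf
  exact ⟨p ^ a, by simp [hp]⟩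

theorem isPolynomial_loopTime (r : ℕ) {T : ℕ → ℕ} (hT : IsPolynomial T) :
    IsPolynomial fun s => loopTime s r (T s) := by
  induction r with
  | zero => exact hT
  | succ r ih =>
    exact (isPolynomial_id.add (isPolynomial_const 1)).mul (ih.add (isPolynomial_const 9))

theorem isPolynomial_verticesTime (q r : ℕ) {T : ℕ → ℕ} (hT : IsPolynomial T) :
    IsPolynomial fun s => verticesTime q r s (T s) := by
  have h1 := isPolynomial_const 1
  have h9 := isPolynomial_const 9
  have hs := isPolynomial_id.add h1
  exact (h1.add (hs.mul (hT.add h9))).add ((((isPolynomial_const q).mul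
    (h1.add (hs.mul ((isPolynomial_loopTime r hT).add h9)))).add h1).add h1)

theorem isPolynomial_constructTime (t q r : ℕ) {N : ℕ → ℕ} (hN : IsPolynomial N) :
    IsPolynomial fun s => constructTime t q r s (N s) := by
  have h1 := isPolynomial_const 1
  have h2 := isPolynomial_const 2
  have hentry : IsPolynomial (entryTime t) :=
    (((isPolynomial_const t).mul (((isPolynomial_const 9).mul isPolynomial_id).add
      (isPolynomial_const 11))).add h1).add (isPolynomial_const _)
  have hmatrix : IsPolynomial (matrixTime t q r) :=
    isPolynomial_verticesTime q r (h1.add (isPolynomial_verticesTime q r hentry))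
  exact (((hmatrix.add ((hN.mul hN).mul h2)).add (hN.mul h2)).add
    (isPolynomial_id.mul (isPolynomial_const 10))).add (isPolynomial_const 20)

/-! ### The reduction -/

section Reduction

variable {V : Type} [DecidableEq V] [Fintype V] (H : SimpleGraph V) (P : Finset V)

/-- The reduction: it attaches `k + 1` copies in each possible way, and keeps the parameter `k`. -/
noncomputable def reduction (I : EdgeDeletionInstance) : EdgeDeletionInstance :=
  ⟨_, attach H P I.G (vertexList P I.n (I.k + 1)), I.k⟩

open Classical in
/-- The entry that the program writes for a pair of vertices that are not both original. -/
noncomputable def newBit (v : Var V) : Bool :=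
  decide (newAdj H P (v.1 false) (v.1 true) fun i j => v.2 i j = true)

open Classical in
omit [DecidableEq V] [Fintype V] in
theorem flatten_adjacencyRows_attach {n : ℕ} (G : SimpleGraph (Fin n)) (vs : List (Vertex V)) :
    (adjacencyRows (attach H P G vs)).flatten =
      vs.flatMap fun u => vs.map fun w => decide (vertexAdj H P G u w) := by
  rw [List.flatMap_def]
  congr 1
  rw [adjacencyRows, ← List.ofFn_getElem_eq_map]
  congr 1
  funext i
  rw [← List.ofFn_getElem_eq_map]
  rfl

open Classical in
omit [Fintype V] in
/-- The rows and columns of the matrix of the constructed graph that belong to original vertices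
form, in this order, the matrix of the given graph. -/
theorem flatten_adjacencyRows_eq {n : ℕ} (G : SimpleGraph (Fin n)) (m : ℕ) (q l : List V) :
    (adjacencyRows G).flatten = (vertices n m q l).flatMap fun u =>
      ((vertices n m q l).filter fun w => u.1.isNone && w.1.isNone).map
        fun w => decide (vertexAdj H P G u w) := by
  have hO : ∀ u ∈ (originals n : List (Vertex V)), u.1 = none := by
    intro u hu
    obtain ⟨a, -, rfl⟩ := List.mem_map.mp hu
    rfl
  have hS : ∀ u ∈ q.flatMap (satellites n m l), u.1.isNone = false := by
    intro u hu
    simp only [satellites, List.mem_flatMap, List.mem_map] at hu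
    obtain ⟨_, _, _, _, _, _, rfl⟩ := hu
    rfl
  have hfilter : (vertices n m q l).filter (fun w => w.1.isNone) = originals n := by
    rw [vertices, List.filter_append, List.filter_eq_self.mpr fun u hu => by simp [hO u hu],
      List.filter_eq_nil_iff.mpr fun u hu => by simp [hS u hu], List.append_nil]
  have hrow : ∀ u : Vertex V, u.1 = none →
      (vertices n m q l).filter (fun w => u.1.isNone && w.1.isNone) = originals n := by
    intro u hu
    rw [← hfilter]
    simp [hu]
  have hnil : ((q.flatMap (satellites n m l)).flatMap fun u =>
      ((vertices n m q l).filter fun w => u.1.isNone && w.1.isNone).map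
        fun w => decide (vertexAdj H P G u w)) = [] := by
    rw [List.flatMap_eq_nil_iff]
    intro u hu
    simp [hS u hu]
  conv_rhs => arg 2; rw [vertices]
  rw [List.flatMap_append, hnil, List.append_nil]
  rw [List.flatMap_congr (g := fun u : Vertex V => (originals n).map
    fun w => decide (vertexAdj H P G u w)) fun u hu => by rw [hrow u (hO u hu)]]
  have horig : (originals n : List (Vertex V)) = List.ofFn fun x : Fin n => original (x : ℕ) := by
    rw [List.ofFn_eq_map, originals, ← List.map_coe_finRange_eq_range, List.map_map]
    rfl
  rw [horig, List.flatMap_def, List.map_ofFn, adjacencyRows]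
  congr 2
  funext x
  rw [Function.comp_apply, List.map_ofFn]
  congr 1
  funext y
  refine decide_eq_decide.mpr ?_
  simp only [vertexAdj, newAdj, original, true_and, false_or, Function.update_self]
  constructor
  · exact fun h => ⟨x, y, h, rfl, rfl⟩
  · rintro ⟨x', y', h, hx, hy⟩
    rwa [Fin.ext hx, Fin.ext hy]

omit [DecidableEq V] [Fintype V] in
theorem newBit_pairVar {n : ℕ} (G : SimpleGraph (Fin n)) (u w : Vertex V)
    (h : ¬(u.1.isNone && w.1.isNone)) [Decidable (vertexAdj H P G u w)] :
    newBit H P (pairVar u w) = decide (vertexAdj H P G u w) := by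
  refine decide_eq_decide.mpr ?_
  have hne : ¬(u.1 = none ∧ w.1 = none) := by simpa using h
  simp only [pairVar, vertexAdj, decide_eq_true_eq, if_true, Bool.false_eq_true, if_false]
  constructor
  · exact Or.inl
  · rintro (h | ⟨h1, h2, -⟩)
    · exact h
    · exact absurd ⟨h1, h2⟩ hne

theorem computableInPolyTime_reduction :
    Nonempty (Turing.TM2ComputableInPolyTime EdgeDeletionInstance.encode
      EdgeDeletionInstance.encode (reduction H P)) := by
  classical
  obtain ⟨p, hp⟩ := isPolynomial_constructTime (Fintype.card (Option V × Option V))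
    Pᶜ.toList.length P.toList.length (isPolynomial_id.add
      ((isPolynomial_const Pᶜ.toList.length).mul
        (isPolynomial_id.mul (isPolynomial_id.pow P.toList.length))))
  refine computableInPolyTime_of_exec (construct Pᶜ.toList P.toList (newBit H P))
    (.inl .input) (.inl .output) (initVar V) p fun I => ?_
  obtain ⟨n, G, k⟩ := I
  have hlen : n + (k + 1) ≤ (EdgeDeletionInstance.encode ⟨n, G, k⟩).length := by
    simp only [EdgeDeletionInstance.encode, List.length_append, List.length_cons,
      List.length_replicate]
    omega
  rw [← hp]
  have h := exec_construct (q := Pᶜ.toList) (Finset.nodup_toList P) (bit := newBit H P)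
    (e := fun u w => decide (vertexAdj H P G u w))
    (fun u w h => newBit_pairVar H P G u w h)
    (n := n) (k := k) (s := (EdgeDeletionInstance.encode ⟨n, G, k⟩).length)
    (N := (EdgeDeletionInstance.encode ⟨n, G, k⟩).length + Pᶜ.toList.length *
      ((EdgeDeletionInstance.encode ⟨n, G, k⟩).length *
        (EdgeDeletionInstance.encode ⟨n, G, k⟩).length ^ P.toList.length))
    (by omega) (by omega) rfl (by
      rw [length_vertices]
      gcongr <;> omega)
  rw [← flatten_adjacencyRows_eq, ← flatten_adjacencyRows_attach] at h
  exact h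

variable {H P}

theorem linearParameterizedReducible_induce [DecidableRel H.Adj] {d : ℤ}
    (hP : ∀ v, v ∈ P ↔ d < (H.degree v : ℤ)) :
    LinearParameterizedReducible (freeEdgeDeletion (H.induce (P : Set V)))
      (freeEdgeDeletion H) := by
  refine ⟨reduction H P, computableInPolyTime_reduction H P, fun I => ⟨isYes_attach hP,
    isYes_of_isYes_attach⟩, 1, fun I => ?_⟩
  rw [one_mul]
  exact le_rfl

end Reduction

theorem freeEdgeDeletion_congr {V W : Type*} {H : SimpleGraph V} {H' : SimpleGraph W}
    (e : H ≃g H') : freeEdgeDeletion H = freeEdgeDeletion H' := by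
  have h : ∀ {n : ℕ} (G : SimpleGraph (Fin n)), H.IsIndContained G ↔ H'.IsIndContained G :=
    fun G => ⟨fun ⟨f⟩ => ⟨f.comp e.symm.toEmbedding⟩, fun ⟨f⟩ => ⟨f.comp e.toEmbedding⟩⟩
  simp only [freeEdgeDeletion, h]

end StackProgram

theorem mainTheorem10 {V : Type*} [Fintype V] (H : SimpleGraph V) [DecidableRel H.Adj] (d : ℤ) :
    LinearParameterizedReducible
      (freeEdgeDeletion (H.induce {v : V | d < (H.degree v : ℤ)}))
      (freeEdgeDeletion H) := by
  classical
  -- stacks are indexed by a type in the lowest universe, so `V` is replaced by `Fin _`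
  let f : V ≃ Fin (Fintype.card V) := Fintype.equivFin V
  let H₀ : SimpleGraph (Fin (Fintype.card V)) := H.comap f.symm
  let e : H ≃g H₀ := ⟨f, by simp [H₀]⟩
  let P : Finset (Fin (Fintype.card V)) :=
    Finset.univ.filter fun v => d < (H₀.degree v : ℤ)
  have hdeg : ∀ v, H₀.degree (e v) = H.degree v := fun v => e.degree_eq v
  have hP : ∀ v, v ∈ P ↔ d < (H₀.degree v : ℤ) := by simp [P]
  let e' : H.induce {v : V | d < (H.degree v : ℤ)} ≃g
      H₀.induce (P : Set (Fin (Fintype.card V))) :=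
    ⟨f.subtypeEquiv fun v => by
      rw [Finset.mem_coe, hP]
      change _ ↔ d < (H₀.degree (e v) : ℤ)
      rw [hdeg]
      rfl, by simp [H₀]⟩
  rw [StackProgram.freeEdgeDeletion_congr e, StackProgram.freeEdgeDeletion_congr e']
  exact StackProgram.linearParameterizedReducible_induce hP
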